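/- **Setting.** Let $G=(V,E)$ be a simple undirected graph on $V=\{1,\dots,N\}$, $N\ge 1$. Write $\mathcal N_i=\{i\}\cup\{j:(i,j)\in E\}$, $N_i=|\mathcal N_i|$, $N_{\min}=\min_i N_i$, $N_{\max}=\max_i N_i$, and let $\gamma(G)$ be the domination number of $G$. Let $\mathcal X$ be the closed Euclidean unit ball of $\mathbb R^d$. Weights are numbers $w_{ij}\ge 0$ ($j\in\mathcal N_i$) with $\sum_{j\in\mathcal N_i}w_{ij}=1$ for every $i$. **MT-FTRL** on a virtual clique with a set $\mathcal C$ of $n=|\mathcal C|$ agents and with parameters $\beta_0,\beta_1,\dots$. For $X\in\mathbb R^{\mathcal C\times d}$ let $\sigma^2(X)=\frac1{n-1}\sum_i\|X_{i:}-\frac1n\sum_kX_{k:}\|^2$, $A=(1+n)I-\mathbf 1\mathbf 1^\top$, $\|X\|_A^2=\mathrm{tr}(X^\top AX)$. For each guess $\xi\in\Xi=\{\frac1n,\frac2n,\dots,1\}$ let $\mathcal U_\xi$ be the set of all $X$ with rows in $\mathcal X$ and, if $\xi<1$, with $\sigma^2(X)\le\xi$ (the guess $\xi=1$ puts no constraint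 on the variance). At its $t$-th round, having received in its rounds $s<t$ the linear losses $\langle h_s,\cdot\rangle$ for the agents $i_s\in\mathcal C$, the algorithm computes $$X^{(\xi)}_t=\operatorname*{argmin}_{X\in\mathcal U_\xi}\ \frac{n}{\beta_{t-1}}\sqrt{1+\xi(n-1)}\sum_{s<t}\langle h_s,X_{i_s:}\rangle+\tfrac12\|X\|_A^2,\qquad p_t^{(\xi)}\propto\exp\Big(-\frac{\sqrt{\ln n}}{\beta_{t-1}}\sum_{s<t}\langle h_s,[X^{(\xi)}_s]_{i_s:}\rangle\Big)$$ ($p_t$ is a probability vector on $\Xi$, and $1/\beta_{t-1}$ is read as $0$ if $\beta_{t-1}=0$) and outputs $\sum_{\xi\in\Xi} p_t^{(\xi)}X_t^{(\xi)}$. **MT-COOL** with weights $w$ and virtual cliques $\mathcal C_j\subseteq\mathcal N_j$. Each agent $j$ runs an instance of MT-FTRL on $\mathcal C_j$ with $\beta_n=\max_{i\in\mathcal N_j}w_{ij}\sqrt{1+n}$, where $n$ counts the past rounds whose active agent is in $\mathcal C_j$. At round $t$ an arbitrary agent $i_t$ is activated. It predicts $x_t=\sum_{j\in\mathcal N_{i_t}:\,i_t\in\mathcal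 C_j}w_{i_tj}[Y^{(j)}_t]_{i_t:}$, where $Y_t^{(j)}$ is the current output of the instance of $j$. It then pays $\ell_t(x_t)$, where $\ell_t:\mathcal X\to\mathbb R$ is convex, and observes a subgradient $g_t\in\partial\ell_t(x_t)$ with $\|g_t\|\le1$. The loss $\langle w_{i_tj}g_t,\cdot\rangle$ for the agent $i_t$ is fed to the instance of each $j\in\mathcal N_{i_t}$ with $i_t\in\mathcal C_j$. For $U=(U_{1:},\dots,U_{N:})$ with rows in $\mathcal X$ let $R_T(U)=\sum_{t=1}^T\big(\ell_t(x_t)-\ell_t(U_{i_t:})\big)$ and $T_i=|\{t\le T:i_t=i\}|$. Let $\sigma_j^2=\frac{1}{2N_j(N_j-1)}\sum_{i,i'\in\mathcal N_j}\|U_{i:}-U_{i':}\|^2$ ($0$ if $N_j=1$), $\sigma^2_{\max}=\max_j\sigma_j^2$, $\bar\sigma^2=\frac1N\sum_j\sigma_j^2$, and $\Delta^2=\sup_{(i,j)\in E}\|U_{i:}-U_{j:}\|^2$ ($0$ if $E=\emptyset$). Write $a=\widetilde{\mathcal O}(b)$ if $a\le C(1+\ln N)^p\,b$, where $C>0$ and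 $p\in\mathbb N$ are absolute constants. **Theorem.** The following hold for every graph $G$, and for all $d$, $T$, all activation sequences, all losses and subgradients as above, and all $U$ with rows in $\mathcal X$. 1. MT-COOL with $\mathcal C_j=\mathcal N_j$ and any weights satisfies $$R_T(U)=\widetilde{\mathcal O}\Big(\sum_{j=1}^N\max_{i\in\mathcal N_j}w_{ij}\,\sqrt{1+\sigma_j^2(N_j-1)}\,\sqrt{\textstyle\sum_{i\in\mathcal N_j}T_i}\Big).$$ 2. MT-COOL with $\mathcal C_j=\mathcal N_j$ and $w_{ij}=\mathbb I\{j\in\mathcal N_i\}/N_i$ satisfies $$R_T(U)=\widetilde{\mathcal O}\Big(\min\Big\{\tfrac{\sqrt{NN_{\max}}}{N_{\min}}\sqrt{1+\sigma^2_{\max}(N_{\max}-1)},\ \tfrac{N}{N_{\min}}\sqrt{1+\bar\sigma^2(N_{\max}-1)}\Big\}\sqrt T\Big).$$ 3. There are weights $w$, depending only on $G$, such that MT-COOL with $\mathcal C_j=\{i\in\mathcal N_j:w_{ij}\ne0\}$ satisfies $$R_T(U)=\widetilde{\mathcal O}\Big(\sqrt{1+\Delta^2(N_{\max}-1)}\,\sqrt{\gamma(G)\,T}\Big).$$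 They can be taken of the form $w_{ij}=\mathbb I\{j=r(i)\}$, where $S$ is a dominating set of size $\gamma(G)$ and $r(i)\in S\cap\mathcal N_i$ for every $i$. -/

import Mathlib

namespace MTCool

noncomputable section

/-- `ℝ^d` with the Euclidean norm. -/
abbrev Vec (d : ℕ) : Type := EuclideanSpace ℝ (Fin d)

/-- The common decision space of the agents: the closed Euclidean unit ball. -/
def decisionSpace (d : ℕ) : Set (Vec d) := Metric.closedBall 0 1

/-! ### The base algorithm `MT-FTRL` on a clique

The agents of the clique are the elements of a finite type `ι`. A matrix in `ℝ^{ι × d}` is the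
function `ι → Vec d` that gives its rows. -/

section Clique

variable {ι : Type} [Fintype ι] {d : ℕ}

/-- The sample variance `σ²(X) = 1/(n-1) ∑ᵢ ‖Xᵢ - n⁻¹ ∑ₖ Xₖ‖²` of the rows of `X`, where `n` is
the number of rows (it is `0` if there is only one row). -/
def variance (X : ι → Vec d) : ℝ :=
  (∑ i, ‖X i - (Fintype.card ι : ℝ)⁻¹ • ∑ k, X k‖ ^ 2) / ((Fintype.card ι : ℝ) - 1)

open Classical in
/-- The matrix `A = (1 + n) I - 1 1ᵀ`. -/
def regMatrix (ι : Type) [Fintype ι] : Matrix ι ι ℝ :=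
  (1 + (Fintype.card ι : ℝ)) • (1 : Matrix ι ι ℝ) - Matrix.of fun _ _ => 1

/-- The squared Mahalanobis norm `‖X‖_A² = tr (Xᵀ A X)`. -/
def mahalanobisSq (X : ι → Vec d) : ℝ :=
  ∑ i, ∑ k, regMatrix ι i k * inner ℝ (X i) (X k)

/-- The variance guess `ξ ∈ {1/n, 2/n, …, 1}` with index `k ∈ {0, …, n - 1}`. -/
def guess (ι : Type) [Fintype ι] (k : Fin (Fintype.card ι)) : ℝ :=
  ((k : ℝ) + 1) / (Fintype.card ι : ℝ)

/-- The matrices over which the expert with variance guess `ξ` optimizes: the rows are in the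
decision space, and the variance is at most `ξ` if `ξ < 1`. The largest guess `ξ = 1` does not
constrain the variance. -/
def feasible (ι : Type) [Fintype ι] (d : ℕ) (ξ : ℝ) : Set (ι → Vec d) :=
  {X | (∀ i, X i ∈ decisionSpace d) ∧ (ξ < 1 → variance X ≤ ξ)}

/-- The feedback received so far by an instance of the base algorithm, in chronological order: at
each (local) round, the index of the active agent and the vector `g` of the linear loss `⟨g, ·⟩`. -/
abbrev History (ι : Type) (d : ℕ) : Type := List (ι × Vec d)

open Classical in
/-- The sum of the gradient matrices `Gₛ = e_{iₛ} gₛᵀ` over the past rounds. -/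
def gradSum (h : History ι d) : ι → Vec d :=
  (h.map fun p => (Pi.single p.1 p.2 : ι → Vec d)).sum

/-- The learning rate `n / β * √(1 + ξ (n - 1))` of the expert with variance guess `ξ`. -/
def learningRate (ι : Type) [Fintype ι] (b ξ : ℝ) : ℝ :=
  (Fintype.card ι : ℝ) / b * √(1 + ξ * ((Fintype.card ι : ℝ) - 1))

/-- The objective `η ⟨∑ₛ Gₛ, X⟩ + ½ ‖X‖_A²` after the history `h`. The sequence `β` is indexed by
the number of rounds played so far by the instance. -/
def objective (β : ℕ → ℝ) (ξ : ℝ) (h : History ι d) (X : ι → Vec d) : ℝ :=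
  learningRate ι (β h.length) ξ * (∑ i, inner ℝ (gradSum h i) (X i)) + 1 / 2 * mahalanobisSq X

theorem exists_minimizer (β : ℕ → ℝ) (k : Fin (Fintype.card ι)) (h : History ι d) :
    ∃ X ∈ feasible ι d (guess ι k), IsMinOn (objective β (guess ι k) h) (feasible ι d (guess ι k)) X
    := by
  have hc : Continuous (variance : (ι → Vec d) → ℝ) := by
    unfold variance; fun_prop
  have hK : IsCompact (Set.univ.pi fun _ : ι => decisionSpace d) :=
    isCompact_univ_pi fun _ => isCompact_closedBall 0 1
  have hF : IsCompact (feasible ι d (guess ι k)) := by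
    by_cases hk : guess ι k < 1
    · have : feasible ι d (guess ι k) =
          (Set.univ.pi fun _ : ι => decisionSpace d) ∩ {X | variance X ≤ guess ι k} := by
        ext X; simp [feasible, hk]
      rw [this]
      exact hK.inter_right (isClosed_le hc continuous_const)
    · have : feasible ι d (guess ι k) = Set.univ.pi fun _ : ι => decisionSpace d := by
        ext X; simp [feasible, hk]
      rw [this]; exact hK
  have h0 : (0 : ι → Vec d) ∈ feasible ι d (guess ι k) := by
    refine ⟨fun i => by simp [decisionSpace], fun _ => ?_⟩
    have : variance (0 : ι → Vec d) = 0 := by simp [variance]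
    rw [this]; unfold guess; positivity
  refine hF.exists_isMinOn ⟨0, h0⟩ (Continuous.continuousOn ?_)
  unfold objective mahalanobisSq
  fun_prop

/-- The prediction `X^{(ξ)}` of the expert with the `k`-th variance guess after the history `h`: the
minimizer of the (strictly convex) objective over the feasible matrices. -/
def expert (β : ℕ → ℝ) (k : Fin (Fintype.card ι)) (h : History ι d) : ι → Vec d :=
  (exists_minimizer β k h).choose

/-- The cumulative linear loss `∑ₛ ⟨gₛ, [Xₛ^{(ξ)}]_{iₛ}⟩` of the `k`-th expert; the expert's
prediction at a past round is based on the feedback received before that round. -/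
def expertLoss (β : ℕ → ℝ) (k : Fin (Fintype.card ι)) (h : History ι d) : ℝ :=
  ∑ s : Fin h.length, inner ℝ (h.get s).2 (expert β k (h.take s) (h.get s).1)

/-- The unnormalized weight of the `k`-th expert in Hedge. -/
def hedgeWeight (β : ℕ → ℝ) (k : Fin (Fintype.card ι)) (h : History ι d) : ℝ :=
  Real.exp (-(√(Real.log (Fintype.card ι)) / β h.length) * expertLoss β k h)

/-- The probability of the `k`-th expert in Hedge (which is `1/n` for the empty history). -/
def hedgeProb (β : ℕ → ℝ) (k : Fin (Fintype.card ι)) (h : History ι d) : ℝ :=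
  hedgeWeight β k h / ∑ k', hedgeWeight β k' h

/-- The prediction of `MT-FTRL` after the history `h`: the Hedge average of the experts. -/
def mtftrl (β : ℕ → ℝ) (h : History ι d) : ι → Vec d :=
  ∑ k, hedgeProb β k h • expert β k h

end Clique

/-! ### Communication graphs -/

section Graph

variable {N : ℕ}

open Classical in
/-- The neighbourhood `𝒩ᵢ` of agent `i`, including `i`. -/
def nbhd (G : SimpleGraph (Fin N)) (i : Fin N) : Finset (Fin N) :=
  Finset.univ.filter fun j => j = i ∨ G.Adj i j

theorem self_mem_nbhd (G : SimpleGraph (Fin N)) (i : Fin N) : i ∈ nbhd G i := by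
  simp [nbhd]

/-- `Nᵢ = |𝒩ᵢ|`. -/
def nbhdSize (G : SimpleGraph (Fin N)) (i : Fin N) : ℕ := (nbhd G i).card

/-- `N_max = maxᵢ Nᵢ`. -/
def maxNbhd [NeZero N] (G : SimpleGraph (Fin N)) : ℕ :=
  Finset.univ.sup' Finset.univ_nonempty (nbhdSize G)

/-- `N_min = minᵢ Nᵢ`. -/
def minNbhd [NeZero N] (G : SimpleGraph (Fin N)) : ℕ :=
  Finset.univ.inf' Finset.univ_nonempty (nbhdSize G)

/-- Every vertex outside `S` has a neighbour in `S`. -/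
def IsDominating (G : SimpleGraph (Fin N)) (S : Finset (Fin N)) : Prop :=
  ∀ v, v ∉ S → ∃ u ∈ S, G.Adj v u

/-- The domination number `γ(G)`. -/
def dominationNumber (G : SimpleGraph (Fin N)) : ℕ :=
  sInf {n | ∃ S : Finset (Fin N), IsDominating G S ∧ S.card = n}

/-- The weights `w i j` are nonnegative and `∑_{j ∈ 𝒩ᵢ} w i j = 1` for every `i`. -/
def IsWeights (G : SimpleGraph (Fin N)) (w : Fin N → Fin N → ℝ) : Prop :=
  ∀ i, (∀ j ∈ nbhd G i, 0 ≤ w i j) ∧ ∑ j ∈ nbhd G i, w i j = 1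

/-- `max_{i ∈ 𝒩ⱼ} w i j`. -/
def maxWeight (G : SimpleGraph (Fin N)) (w : Fin N → Fin N → ℝ) (j : Fin N) : ℝ :=
  (nbhd G j).sup' ⟨j, self_mem_nbhd G j⟩ fun i => w i j

open Classical in
/-- The uniform weights `w i j = 𝟙{j ∈ 𝒩ᵢ} / Nᵢ`. -/
def uniformWeights (G : SimpleGraph (Fin N)) (i j : Fin N) : ℝ :=
  if j ∈ nbhd G i then 1 / (nbhdSize G i : ℝ) else 0

/-- The weights with which each agent `i` follows only the agent `r i`. -/
def delegationWeights (r : Fin N → Fin N) (i j : Fin N) : ℝ :=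
  if j = r i then 1 else 0

/-- The agents in `𝒩ⱼ` that give a nonzero weight to `j`. -/
def followers (G : SimpleGraph (Fin N)) (w : Fin N → Fin N → ℝ) (j : Fin N) : Finset (Fin N) :=
  (nbhd G j).filter fun i => w i j ≠ 0

end Graph

/-! ### The algorithm `MT-COOL`

In the definitions below `C j` is the set of agents of the virtual clique on which agent `j` runs
its instance of `MT-FTRL`. The choice `C j = 𝒩ⱼ` is `C = nbhd G`. -/

section Algorithm

variable {N d : ℕ}

/-- The feedback received by the instance of agent `j` before round `t`: for each round `s < t`
whose active agent `iₛ` is in the virtual clique of `j`, the index `iₛ` and the vector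
`w_{iₛ j} gₛ`. -/
def localHistory (C : Fin N → Finset (Fin N)) (w : Fin N → Fin N → ℝ)
    (act : ℕ → Fin N) (g : ℕ → Vec d) (j : Fin N) (t : ℕ) : History {i // i ∈ C j} d :=
  (List.range t).filterMap fun s =>
    if hs : act s ∈ C j then some (⟨act s, hs⟩, w (act s) j • g s) else none

/-- The parameters `max_{i ∈ 𝒩ⱼ} w i j * √(1 + n)` of the instance of agent `j`, where `n` is the
number of past rounds of the instance, i.e. of past activations of agents of its virtual clique. -/
def localBeta (G : SimpleGraph (Fin N)) (w : Fin N → Fin N → ℝ) (j : Fin N) (n : ℕ) : ℝ :=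
  maxWeight G w j * √(1 + (n : ℝ))

/-- The matrix `Y_t^{(j)}` of models maintained by agent `j`. -/
def localModel (G : SimpleGraph (Fin N)) (C : Fin N → Finset (Fin N)) (w : Fin N → Fin N → ℝ)
    (act : ℕ → Fin N) (g : ℕ → Vec d) (j : Fin N) (t : ℕ) : {i // i ∈ C j} → Vec d :=
  mtftrl (localBeta G w j) (localHistory C w act g j t)

/-- The prediction `x_t = ∑_{j ∈ 𝒩_{i_t}} w_{i_t j} [Y_t^{(j)}]_{i_t}` of the active agent `i_t`
(the sum is over those `j` whose virtual clique contains `i_t`). -/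
def prediction (G : SimpleGraph (Fin N)) (C : Fin N → Finset (Fin N)) (w : Fin N → Fin N → ℝ)
    (act : ℕ → Fin N) (g : ℕ → Vec d) (t : ℕ) : Vec d :=
  ∑ j ∈ nbhd G (act t),
    if ht : act t ∈ C j then w (act t) j • localModel G C w act g j t ⟨act t, ht⟩ else 0

/-- `g` is a subgradient at `x` of `f`, as a function on the decision space. -/
def IsSubgradient (f : Vec d → ℝ) (x g : Vec d) : Prop :=
  ∀ y ∈ decisionSpace d, f x + inner ℝ g (y - x) ≤ f y

/-- The rounds `0, …, T - 1` of `MT-COOL` with activations `act`, convex losses `loss t` and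
observed subgradients `g t` at the predictions, of norm at most `1`. -/
def IsRun (G : SimpleGraph (Fin N)) (C : Fin N → Finset (Fin N)) (w : Fin N → Fin N → ℝ)
    (T : ℕ) (act : ℕ → Fin N) (loss : ℕ → Vec d → ℝ) (g : ℕ → Vec d) : Prop :=
  ∀ t < T, ConvexOn ℝ (decisionSpace d) (loss t) ∧
    IsSubgradient (loss t) (prediction G C w act g t) (g t) ∧ ‖g t‖ ≤ 1

/-- The multitask regret `R_T(U) = ∑_t (ℓ_t(x_t) - ℓ_t(U_{i_t}))`. -/
def regret (G : SimpleGraph (Fin N)) (C : Fin N → Finset (Fin N)) (w : Fin N → Fin N → ℝ)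
    (T : ℕ) (act : ℕ → Fin N) (loss : ℕ → Vec d → ℝ) (g : ℕ → Vec d) (U : Fin N → Vec d) : ℝ :=
  ∑ t ∈ Finset.range T, (loss t (prediction G C w act g t) - loss t (U (act t)))

/-- The number `Tᵢ` of rounds `t < T` at which agent `i` is active. -/
def activeCount (T : ℕ) (act : ℕ → Fin N) (i : Fin N) : ℕ :=
  ((Finset.range T).filter fun t => act t = i).card

/-- The local task variance `σⱼ² = 1/(2 Nⱼ (Nⱼ - 1)) ∑_{i, i' ∈ 𝒩ⱼ} ‖Uᵢ - Uᵢ'‖²` (which is `0` if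
`Nⱼ = 1`). -/
def localVariance (G : SimpleGraph (Fin N)) (U : Fin N → Vec d) (j : Fin N) : ℝ :=
  (∑ i ∈ nbhd G j, ∑ i' ∈ nbhd G j, ‖U i - U i'‖ ^ 2) /
    (2 * (nbhdSize G j : ℝ) * ((nbhdSize G j : ℝ) - 1))

/-- `σ_max² = maxⱼ σⱼ²`. -/
def maxVariance [NeZero N] (G : SimpleGraph (Fin N)) (U : Fin N → Vec d) : ℝ :=
  Finset.univ.sup' Finset.univ_nonempty (localVariance G U)

/-- The average local variance. -/
def avgVariance (G : SimpleGraph (Fin N)) (U : Fin N → Vec d) : ℝ :=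
  1 / (N : ℝ) * ∑ j, localVariance G U j

/-- `Δ² = sup_{(i,j) ∈ E} ‖Uᵢ - Uⱼ‖²` (which is `0` if there is no edge). -/
def edgeVariation (G : SimpleGraph (Fin N)) (U : Fin N → Vec d) : ℝ :=
  ⨆ e : {e : Fin N × Fin N // G.Adj e.1 e.2}, ‖U e.1.1 - U e.1.2‖ ^ 2

end Algorithm

end

end MTCool

namespace MTCool

noncomputable section

/-! ### Sums along the prefixes of a list -/

/-! Convexity bounds the regret by `∑ ⟨g_t, x_t - U_{i_t}⟩`. Since the weights of each agent sum to
one, this linear regret is exactly the sum over `j` of the linear regrets of the base instances,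
each run on its own local history (`inner_prediction_sub`, `sum_range_localModel_eq_onlineSum`).
Everything then rests on a bound for one clique, `onlineSum_mtftrl_sub_le`.

On a clique of size `n` the regularizer is `‖X‖_A² = ∑ ‖X_i‖² + n · scatter X`. It is large enough
that `n ‖X_i‖² ≤ 2 ‖X‖_A²`, so a gradient of norm `b` supported on a single row has squared dual
norm of order `b² / n`. On the matrices of variance at most `ξ` it is at most `2n (1 + ξ(n-1))`.
Follow-the-regularized-leader with the learning rate that balances these two quantities has regret
of order `b √(1 + ξ(n-1)) √m` after `m` rounds (`expertLoss_sub_le`). Hedge over the `n` guesses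
adds order `b √(ln n) √m` (`mtftrlLoss_sub_expertLoss_le`), and rounding the true variance up to the
grid raises `ξ(n-1)` by at most one (`exists_guess`).

It remains to sum over `j`. For uniform weights, Cauchy–Schwarz is applied either to the activation
counts, each of which is counted at most `N_max` times, or to the local variances. For a dominating
set, the cliques are the fibres of `r`, so the counts add up to `T` over `γ(G)` nonempty cliques at
most, and the variance within a clique is controlled by the edges to its centre. -/

/-- The sum `∑ₛ f (h₀, …, hₛ₋₁) hₛ` of the losses along a history. -/
def onlineSum {α : Type*} (f : List α → α → ℝ) (h : List α) : ℝ :=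
  ∑ s : Fin h.length, f (h.take s) (h.get s)

theorem onlineSum_nil {α : Type*} (f : List α → α → ℝ) : onlineSum f [] = 0 := by
  simp [onlineSum]

theorem onlineSum_append_singleton {α : Type*} (f : List α → α → ℝ) (h : List α) (p : α) :
    onlineSum f (h ++ [p]) = onlineSum f h + f h p := by
  have hl : (h ++ [p]).length = h.length + 1 := by simp
  unfold onlineSum
  rw [← Equiv.sum_comp (finCongr hl.symm), Fin.sum_univ_castSucc]
  congr 1
  · refine Finset.sum_congr rfl fun s _ => ?_
    have hs : (s : ℕ) < h.length := s.2
    simp [List.take_append_of_le_length hs.le]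
  · simp

theorem onlineSum_sub {α : Type*} (f f' : List α → α → ℝ) (h : List α) :
    onlineSum (fun h p => f h p - f' h p) h = onlineSum f h - onlineSum f' h := by
  simp [onlineSum]

/-! ### Expert losses as sums along the history -/

section Clique

variable {ι : Type} [Fintype ι] {d : ℕ}

theorem expertLoss_eq_onlineSum (β : ℕ → ℝ) (k : Fin (Fintype.card ι)) (h : History ι d) :
    expertLoss β k h = onlineSum (fun h p => inner ℝ p.2 (expert β k h p.1)) h := by
  unfold expertLoss onlineSum
  rfl

theorem expertLoss_nil (β : ℕ → ℝ) (k : Fin (Fintype.card ι)) :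
    expertLoss β k ([] : History ι d) = 0 := by
  simp [expertLoss]

theorem expertLoss_append_singleton (β : ℕ → ℝ) (k : Fin (Fintype.card ι)) (h : History ι d)
    (p : ι × Vec d) :
    expertLoss β k (h ++ [p]) = expertLoss β k h + inner ℝ p.2 (expert β k h p.1) := by
  simp only [expertLoss_eq_onlineSum, onlineSum_append_singleton]

theorem sum_inner_gradSum_append_singleton (h : History ι d) (p : ι × Vec d) (X : ι → Vec d) :
    ∑ i, inner ℝ (gradSum (h ++ [p]) i) (X i) =
      ∑ i, inner ℝ (gradSum h i) (X i) + inner ℝ p.2 (X p.1) := by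
  classical
  have : gradSum (h ++ [p]) = gradSum h + Pi.single p.1 p.2 := by
    simp only [gradSum, List.map_append, List.sum_append, List.map_cons, List.map_nil,
      List.sum_cons, List.sum_nil, add_zero]
  simp only [this, Pi.add_apply, inner_add_left, Finset.sum_add_distrib, add_right_inj]
  rw [Finset.sum_eq_single p.1]
  · simp
  · intro i _ hi
    simp [hi]
  · simp

theorem onlineSum_inner_eq (X : ι → Vec d) (h : History ι d) :
    onlineSum (fun _ p => inner ℝ p.2 (X p.1)) h = ∑ i, inner ℝ (gradSum h i) (X i) := by
  induction h using List.reverseRecOn with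
  | nil => simp [onlineSum_nil, gradSum]
  | append_singleton h p ih =>
    rw [onlineSum_append_singleton, sum_inner_gradSum_append_singleton, ih]

/-! ### The variance and the Mahalanobis norm -/

/-- The sum of squared deviations from the mean. -/
def scatter (X : ι → Vec d) : ℝ :=
  ∑ i, ‖X i - (Fintype.card ι : ℝ)⁻¹ • ∑ k, X k‖ ^ 2

theorem scatter_nonneg (X : ι → Vec d) : 0 ≤ scatter X :=
  Finset.sum_nonneg fun _ _ => sq_nonneg _

/-- Bias–variance decomposition: deviations from the mean sum to zero, so the cross term vanishes.
-/
theorem scatter_eq_sum_sub [Nonempty ι] (X : ι → Vec d) (v : Vec d) :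
    scatter X = ∑ i, ‖X i - v‖ ^ 2 -
      Fintype.card ι * ‖(Fintype.card ι : ℝ)⁻¹ • ∑ k, X k - v‖ ^ 2 := by
  have hn : (Fintype.card ι : ℝ) ≠ 0 := by simp
  set m := (Fintype.card ι : ℝ)⁻¹ • ∑ k, X k with hm
  have hs : ∑ k, X k = (Fintype.card ι : ℝ) • m := by rw [hm, smul_smul, mul_inv_cancel₀ hn, one_smul]
  have h1 : ∀ i, ‖X i - v‖ ^ 2 = ‖X i - m‖ ^ 2 + 2 * inner ℝ (X i - m) (m - v) + ‖m - v‖ ^ 2 := by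
    intro i
    rw [← norm_add_sq_real]; congr 2; abel
  have h2 : ∑ i, inner ℝ (X i - m) (m - v) = 0 := by
    rw [← sum_inner, Finset.sum_sub_distrib, hs]
    simp [Nat.cast_smul_eq_nsmul]
  simp only [h1, Finset.sum_add_distrib, ← Finset.mul_sum, h2]
  simp [scatter, ← hm]

theorem scatter_le_sum_sub [Nonempty ι] (X : ι → Vec d) (v : Vec d) :
    scatter X ≤ ∑ i, ‖X i - v‖ ^ 2 := by
  rw [scatter_eq_sum_sub X v]
  have : 0 ≤ (Fintype.card ι : ℝ) * ‖(Fintype.card ι : ℝ)⁻¹ • ∑ k, X k - v‖ ^ 2 := by positivity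
  linarith

theorem card_mul_scatter [Nonempty ι] (X : ι → Vec d) :
    Fintype.card ι * scatter X = Fintype.card ι * ∑ i, ‖X i‖ ^ 2 - ‖∑ i, X i‖ ^ 2 := by
  have hn : (Fintype.card ι : ℝ) ≠ 0 := by simp
  rw [scatter_eq_sum_sub X 0]
  simp only [sub_zero, norm_smul, mul_pow, norm_inv, Real.norm_natCast]
  field_simp

theorem sum_sum_norm_sub_sq [Nonempty ι] (X : ι → Vec d) :
    ∑ i, ∑ k, ‖X i - X k‖ ^ 2 = 2 * Fintype.card ι * scatter X := by
  rw [mul_assoc, card_mul_scatter]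
  simp only [norm_sub_sq_real, Finset.sum_add_distrib, Finset.sum_sub_distrib, ← Finset.mul_sum,
    ← inner_sum, ← sum_inner, real_inner_self_eq_norm_sq, Finset.sum_const, Finset.card_univ,
    nsmul_eq_mul]
  ring

/-- The product form avoids the degenerate denominator: a single row has zero scatter, which matches
the value `0` of the division by zero. -/
theorem variance_mul_card_sub_one [Nonempty ι] (X : ι → Vec d) :
    variance X * ((Fintype.card ι : ℝ) - 1) = scatter X := by
  rcases eq_or_ne (Fintype.card ι : ℝ) 1 with h1 | h1
  · have := sum_sum_norm_sub_sq X
    have hs : Subsingleton ι := by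
      rw [← Fintype.card_le_one_iff_subsingleton]; exact_mod_cast h1.le
    have h0 : ∀ i k, X i - X k = 0 := fun i k => by rw [Subsingleton.elim i k, sub_self]
    simp only [h0, h1] at this
    rw [h1]; simp at this; simp [this]
  · unfold variance scatter
    field_simp [sub_ne_zero.2 h1]

theorem variance_nonneg [Nonempty ι] (X : ι → Vec d) : 0 ≤ variance X := by
  have : (1 : ℝ) ≤ Fintype.card ι := by exact_mod_cast Fintype.card_pos
  exact div_nonneg (Finset.sum_nonneg fun _ _ => sq_nonneg _) (by linarith)

theorem mahalanobisSq_eq [Nonempty ι] (X : ι → Vec d) :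
    mahalanobisSq X = ∑ i, ‖X i‖ ^ 2 + Fintype.card ι * scatter X := by
  classical
  rw [card_mul_scatter]
  have h1 : ∀ i k, regMatrix ι i k * inner ℝ (X i) (X k) =
      (if i = k then (1 + (Fintype.card ι : ℝ)) * inner ℝ (X i) (X k) else 0) -
        inner ℝ (X i) (X k) := by
    intro i k
    by_cases h : i = k
    · simp [regMatrix, h]
      ring
    · simp [regMatrix, h]
  simp only [mahalanobisSq, h1, Finset.sum_sub_distrib, Finset.sum_ite_eq, Finset.mem_univ, if_true,
    ← inner_sum, ← sum_inner, real_inner_self_eq_norm_sq, ← Finset.mul_sum]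
  ring

theorem mahalanobisSq_nonneg [Nonempty ι] (X : ι → Vec d) : 0 ≤ mahalanobisSq X := by
  rw [mahalanobisSq_eq]
  have := scatter_nonneg X
  positivity

/-- Split a row into its deviation from the mean and the mean `m`: the first is part of the scatter,
and `n ‖m‖² ≤ ∑ ‖X_k‖²`. This is where sharing between tasks pays: a change in one row costs `n`
times its squared size. -/
theorem card_mul_norm_sq_le_mahalanobisSq [Nonempty ι] (X : ι → Vec d) (i : ι) :
    Fintype.card ι * ‖X i‖ ^ 2 ≤ 2 * mahalanobisSq X := by
  have hn : (0 : ℝ) ≤ Fintype.card ι := by positivity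
  set m := (Fintype.card ι : ℝ)⁻¹ • ∑ k, X k with hm
  have h1 : ‖X i - m‖ ^ 2 ≤ scatter X :=
    Finset.single_le_sum (f := fun i => ‖X i - m‖ ^ 2) (fun _ _ => sq_nonneg _) (Finset.mem_univ i)
  have h2 : Fintype.card ι * ‖m‖ ^ 2 ≤ ∑ k, ‖X k‖ ^ 2 := by
    have := scatter_eq_sum_sub X 0
    simp only [sub_zero, ← hm] at this
    linarith [scatter_nonneg X]
  have h3 : ‖X i‖ ^ 2 ≤ 2 * (‖X i - m‖ ^ 2 + ‖m‖ ^ 2) := by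
    have h4 : ‖X i‖ ≤ ‖X i - m‖ + ‖m‖ := by simpa using norm_add_le (X i - m) m
    nlinarith [sq_nonneg (‖X i - m‖ - ‖m‖), norm_nonneg (X i)]
  rw [mahalanobisSq_eq]
  nlinarith [mul_le_mul_of_nonneg_left h3 hn, mul_le_mul_of_nonneg_left h1 hn]

theorem scatter_midpoint_le (X Y : ι → Vec d) :
    scatter (fun i => (1 / 2 : ℝ) • (X i + Y i)) ≤ (scatter X + scatter Y) / 2 := by
  unfold scatter
  rw [← Finset.sum_add_distrib, Finset.sum_div]
  refine Finset.sum_le_sum fun i _ => ?_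
  rw [← Finset.smul_sum, Finset.sum_add_distrib]
  set n := (Fintype.card ι : ℝ)⁻¹
  have : (1 / 2 : ℝ) • (X i + Y i) - n • (1 / 2 : ℝ) • (∑ k, X k + ∑ k, Y k) =
      (1 / 2 : ℝ) • ((X i - n • ∑ k, X k) + (Y i - n • ∑ k, Y k)) := by module
  rw [this, norm_smul, mul_pow]
  set x := X i - n • ∑ k, X k
  set y := Y i - n • ∑ k, Y k
  have := parallelogram_law_with_norm ℝ x y
  norm_num
  nlinarith [mul_self_nonneg ‖x - y‖]

theorem mahalanobisSq_midpoint (X Y : ι → Vec d) :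
    mahalanobisSq (fun i => (1 / 2 : ℝ) • (X i + Y i)) =
      (mahalanobisSq X + mahalanobisSq Y) / 2 - mahalanobisSq (fun i => Y i - X i) / 4 := by
  unfold mahalanobisSq
  rw [← Finset.sum_add_distrib, Finset.sum_div, Finset.sum_div, ← Finset.sum_sub_distrib]
  refine Finset.sum_congr rfl fun i _ => ?_
  rw [← Finset.sum_add_distrib, Finset.sum_div, Finset.sum_div, ← Finset.sum_sub_distrib]
  refine Finset.sum_congr rfl fun k _ => ?_
  simp only [inner_smul_left, inner_smul_right, inner_add_left, inner_add_right, inner_sub_left,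
    inner_sub_right, map_div₀, map_one, map_ofNat]
  ring

/-! ### Regret of one expert -/

theorem midpoint_mem_feasible {ξ : ℝ} {X Y : ι → Vec d} (hX : X ∈ feasible ι d ξ)
    (hY : Y ∈ feasible ι d ξ) : (fun i => (1 / 2 : ℝ) • (X i + Y i)) ∈ feasible ι d ξ := by
  refine ⟨fun i => ?_, fun h => ?_⟩
  · beta_reduce
    rw [smul_add]
    exact convex_closedBall (0 : Vec d) 1 (hX.1 i) (hY.1 i) (by norm_num) (by norm_num)
      (by norm_num)
  · cases isEmpty_or_nonempty ι
    · have := hX.2 h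
      simp [variance] at this ⊢
      exact this
    · have h1 := hX.2 h
      have h2 := hY.2 h
      have hn : (1 : ℝ) ≤ Fintype.card ι := by exact_mod_cast Fintype.card_pos
      have h3 : variance (fun i => (1 / 2 : ℝ) • (X i + Y i)) ≤ (variance X + variance Y) / 2 := by
        have := div_le_div_of_nonneg_right (scatter_midpoint_le X Y) (sub_nonneg.2 hn)
        refine this.trans_eq ?_
        simp only [variance, scatter]
        ring
      linarith

theorem mahalanobisSq_le_of_mem_feasible [Nonempty ι] {ξ : ℝ} (h1 : ξ ≤ 1) {X : ι → Vec d}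
    (hX : X ∈ feasible ι d ξ) :
    mahalanobisSq X ≤ 2 * (Fintype.card ι * (1 + ξ * ((Fintype.card ι : ℝ) - 1))) := by
  have hn : (1 : ℝ) ≤ Fintype.card ι := by exact_mod_cast Fintype.card_pos
  have hsum : ∑ i, ‖X i‖ ^ 2 ≤ Fintype.card ι := by
    have : ∀ i ∈ Finset.univ, ‖X i‖ ^ 2 ≤ (1 : ℝ) := fun i _ => by
      have := mem_closedBall_zero_iff.1 (hX.1 i)
      exact pow_le_one₀ (norm_nonneg _) this
    simpa using Finset.sum_le_sum this
  rw [mahalanobisSq_eq]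
  rcases h1.lt_or_eq with h | rfl
  · have h2 := hX.2 h
    have h3 := variance_mul_card_sub_one X
    have h4 : scatter X ≤ ξ * ((Fintype.card ι : ℝ) - 1) := by
      rw [← h3]; exact mul_le_mul_of_nonneg_right h2 (by linarith)
    have h5 := scatter_nonneg X
    nlinarith [mul_le_mul_of_nonneg_left h4 (zero_le_one.trans hn)]
  -- The guess `1` leaves the variance free, so only `scatter X ≤ n` is available, not `n - 1`; the
  -- factor `2` in the bound absorbs `n + n² ≤ 2n²`.
  · have h4 : scatter X ≤ Fintype.card ι := by
      refine le_trans ?_ hsum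
      simpa using scatter_le_sum_sub X 0
    nlinarith

theorem expert_mem (β : ℕ → ℝ) (k : Fin (Fintype.card ι)) (h : History ι d) :
    expert β k h ∈ feasible ι d (guess ι k) :=
  (exists_minimizer β k h).choose_spec.1

theorem norm_expert_le (β : ℕ → ℝ) (k : Fin (Fintype.card ι)) (h : History ι d) (i : ι) :
    ‖expert β k h i‖ ≤ 1 :=
  mem_closedBall_zero_iff.1 ((expert_mem β k h).1 i)

theorem objective_expert_le (β : ℕ → ℝ) (k : Fin (Fintype.card ι)) (h : History ι d)
    {X : ι → Vec d} (hX : X ∈ feasible ι d (guess ι k)) :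
    objective β (guess ι k) h (expert β k h) ≤ objective β (guess ι k) h X :=
  (exists_minimizer β k h).choose_spec.2 hX

/-- Strong convexity at the minimizer, by comparing it with the midpoint to `X`, which is feasible.
The parallelogram identity makes the objective there smaller than the average by an eighth of the
squared distance; doubling gives the `1 / 4`. -/
theorem objective_expert_add_le (β : ℕ → ℝ) (k : Fin (Fintype.card ι)) (h : History ι d)
    {X : ι → Vec d} (hX : X ∈ feasible ι d (guess ι k)) :
    objective β (guess ι k) h (expert β k h) + mahalanobisSq (fun i => X i - expert β k h i) / 4 ≤
      objective β (guess ι k) h X := by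
  have h1 := objective_expert_le β k h (midpoint_mem_feasible (expert_mem β k h) hX)
  set Z := expert β k h
  have h2 : ∑ i, inner ℝ (gradSum h i) ((1 / 2 : ℝ) • (Z i + X i)) =
      (∑ i, inner ℝ (gradSum h i) (Z i) + ∑ i, inner ℝ (gradSum h i) (X i)) / 2 := by
    rw [← Finset.sum_add_distrib, Finset.sum_div]
    refine Finset.sum_congr rfl fun i _ => ?_
    rw [inner_smul_right, inner_add_right]; ring
  unfold objective at h1 ⊢
  rw [h2, mahalanobisSq_midpoint] at h1
  linarith

/-- Telescoping form of `∑ 1/√(1+m) ≤ 2√T`, ready for inductions on the history. -/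
theorem one_div_sqrt_le (m : ℕ) : 1 / √(1 + (m : ℝ)) ≤ 2 * (√((m : ℝ) + 1) - √m) := by
  have h0 : 0 < √((m : ℝ) + 1) := by positivity
  have h1 : √(m : ℝ) ≤ √((m : ℝ) + 1) := Real.sqrt_le_sqrt (by linarith)
  have h2 := Real.sq_sqrt (show (0 : ℝ) ≤ m by positivity)
  have h3 := Real.sq_sqrt (show (0 : ℝ) ≤ m + 1 by positivity)
  rw [add_comm, div_le_iff₀ h0]
  nlinarith [Real.sqrt_nonneg (m : ℝ)]

/-- The parameters `b √(1 + n)` of the base algorithm. -/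
def sqrtBeta (b : ℝ) (n : ℕ) : ℝ := b * √(1 + (n : ℝ))

theorem guess_pos (k : Fin (Fintype.card ι)) : 0 < guess ι k := by
  have : 0 < Fintype.card ι := k.pos
  unfold guess; positivity

theorem guess_le_one (k : Fin (Fintype.card ι)) : guess ι k ≤ 1 := by
  have h : 0 < Fintype.card ι := k.pos
  unfold guess
  rw [div_le_one (by exact_mod_cast h)]
  exact_mod_cast k.2

theorem one_le_one_add_guess_mul (k : Fin (Fintype.card ι)) :
    1 ≤ 1 + guess ι k * ((Fintype.card ι : ℝ) - 1) := by
  have hn : (1 : ℝ) ≤ Fintype.card ι := by exact_mod_cast k.pos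
  nlinarith [guess_pos k]

theorem learningRate_sqrtBeta {b : ℝ} (hb : 0 < b) (k : Fin (Fintype.card ι)) (m : ℕ) :
    0 < learningRate ι (sqrtBeta b m) (guess ι k) := by
  have h1 := one_le_one_add_guess_mul k
  have hn : 0 < Fintype.card ι := k.pos
  unfold learningRate sqrtBeta
  positivity

/-- Induction on the history with the minimum of the objective, divided by the current learning
rate, as potential. After this division the linear part does not depend on the rate, and the
regularizer only grows as the rate decreases. -/
theorem expertLoss_le [Nonempty ι] {b : ℝ} (hb : 0 < b) (k : Fin (Fintype.card ι))
    (h : History ι d) (hh : ∀ p ∈ h, ‖p.2‖ ≤ b) :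
    expertLoss (sqrtBeta b) k h ≤
      objective (sqrtBeta b) (guess ι k) h (expert (sqrtBeta b) k h) /
        learningRate ι (sqrtBeta b h.length) (guess ι k) +
      4 * (b * √(1 + guess ι k * ((Fintype.card ι : ℝ) - 1)) * √h.length) := by
  induction h using List.reverseRecOn with
  | nil =>
    have := mahalanobisSq_nonneg (expert (sqrtBeta b) k ([] : History ι d))
    have h2 := (learningRate_sqrtBeta hb k 0).le
    rw [expertLoss_nil]
    simp only [objective, gradSum, List.map_nil, List.sum_nil, Pi.zero_apply, inner_zero_left,
      Finset.sum_const_zero, mul_zero, zero_add, List.length_nil, Nat.cast_zero, Real.sqrt_zero,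
      add_zero]
    positivity
  | append_singleton h p ih =>
    have ih := ih fun q hq => hh q (by simp [hq])
    have hp : ‖p.2‖ ≤ b := hh p (by simp)
    rw [expertLoss_append_singleton]
    set β := sqrtBeta b with hβ
    set ξ := guess ι k with hξ
    set X := expert β k h
    set Y := expert β k (h ++ [p]) with hY
    have hYf : Y ∈ feasible ι d ξ := expert_mem β k _
    have hconv := objective_expert_add_le β k h hYf
    have hη : 0 < learningRate ι (β h.length) ξ := learningRate_sqrtBeta hb k _
    have hη' : 0 < learningRate ι (β (h ++ [p]).length) ξ := learningRate_sqrtBeta hb k _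
    have hmono : learningRate ι (β (h ++ [p]).length) ξ ≤ learningRate ι (β h.length) ξ := by
      simp only [learningRate, hβ, sqrtBeta, List.length_append, List.length_singleton,
        Nat.cast_add, Nat.cast_one]
      gcongr
      linarith
    have hn : (1 : ℝ) ≤ Fintype.card ι := by exact_mod_cast k.pos
    have hA := card_mul_norm_sq_le_mahalanobisSq (fun i => Y i - X i) p.1
    have hin : -(b * ‖Y p.1 - X p.1‖) ≤ inner ℝ p.2 (Y p.1) - inner ℝ p.2 (X p.1) := by
      rw [← inner_sub_right]
      have h1 := neg_le_of_abs_le (abs_real_inner_le_norm p.2 (Y p.1 - X p.1))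
      have h2 := mul_le_mul_of_nonneg_right hp (norm_nonneg (Y p.1 - X p.1))
      linarith
    -- The tuning of the learning rate turns the stability cost `b² η / n` of a round into a
    -- multiple of `1/√(1+m)`, which telescopes.
    have hstab : b * √(1 + ξ * ((Fintype.card ι : ℝ) - 1)) * (1 / √(1 + (h.length : ℝ))) =
        b ^ 2 * learningRate ι (β h.length) ξ / Fintype.card ι := by
      simp only [learningRate, hβ, sqrtBeta]
      field_simp
    have hsq := mul_le_mul_of_nonneg_left (one_div_sqrt_le h.length)
      (show 0 ≤ b * √(1 + ξ * ((Fintype.card ι : ℝ) - 1)) by positivity)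
    rw [hstab] at hsq
    have hlen : ((h ++ [p]).length : ℝ) = h.length + 1 := by simp
    have hR := mahalanobisSq_nonneg Y
    have hobj : objective β ξ h Y / learningRate ι (β h.length) ξ + inner ℝ p.2 (Y p.1) ≤
        objective β ξ (h ++ [p]) Y / learningRate ι (β (h ++ [p]).length) ξ := by
      simp only [objective, sum_inner_gradSum_append_singleton, add_div]
      rw [mul_div_cancel_left₀ _ hη.ne', mul_div_cancel_left₀ _ hη'.ne']
      have : 1 / 2 * mahalanobisSq Y / learningRate ι (β h.length) ξ ≤
          1 / 2 * mahalanobisSq Y / learningRate ι (β (h ++ [p]).length) ξ := by gcongr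
      linarith
    have hconv' := div_le_div_of_nonneg_right hconv hη.le
    rw [add_div] at hconv'
    rw [hlen]
    set η := learningRate ι (β h.length) ξ
    set y := ‖Y p.1 - X p.1‖
    set M := mahalanobisSq fun i => Y i - X i
    -- Young's inequality, by completing a square: the strong convexity gain pays for the movement
    -- of the active row, up to the stability cost.
    have hquad : b * y ≤ M / 4 / η + 2 * (b ^ 2 * η / Fintype.card ι) := by
      have h1 : Fintype.card ι * y ^ 2 / 8 / η ≤ M / 4 / η :=
        div_le_div_of_nonneg_right (by linarith) hη.le
      refine le_trans ?_ (add_le_add_left h1 _)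
      have h2 : 0 ≤ (Fintype.card ι * y / 4 - b * η) ^ 2 * (2 / (η * Fintype.card ι)) := by
        positivity
      have h3 : (Fintype.card ι * y / 4 - b * η) ^ 2 * (2 / (η * Fintype.card ι)) =
          Fintype.card ι * y ^ 2 / 8 / η + 2 * (b ^ 2 * η / Fintype.card ι) - b * y := by
        field_simp
        ring
      linarith
    linarith

theorem expertLoss_sub_le [Nonempty ι] {b : ℝ} (hb : 0 < b) (k : Fin (Fintype.card ι))
    (h : History ι d) (hh : ∀ p ∈ h, ‖p.2‖ ≤ b) {V : ι → Vec d}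
    (hV : V ∈ feasible ι d (guess ι k)) :
    expertLoss (sqrtBeta b) k h - ∑ i, inner ℝ (gradSum h i) (V i) ≤
      b * √(1 + guess ι k * ((Fintype.card ι : ℝ) - 1)) *
        (4 * √h.length + √(1 + (h.length : ℝ))) := by
  have h1 := expertLoss_le hb k h hh
  have hη : 0 < learningRate ι (sqrtBeta b h.length) (guess ι k) := learningRate_sqrtBeta hb k _
  have h2 := div_le_div_of_nonneg_right (objective_expert_le (sqrtBeta b) k h hV) hη.le
  have h3 : objective (sqrtBeta b) (guess ι k) h V /
      learningRate ι (sqrtBeta b h.length) (guess ι k) = ∑ i, inner ℝ (gradSum h i) (V i) +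
        1 / 2 * mahalanobisSq V / learningRate ι (sqrtBeta b h.length) (guess ι k) := by
    simp only [objective, add_div]
    rw [mul_div_cancel_left₀ _ hη.ne']
  have hM := mahalanobisSq_le_of_mem_feasible (guess_le_one k) hV
  have h4 : 1 / 2 * mahalanobisSq V / learningRate ι (sqrtBeta b h.length) (guess ι k) ≤
      b * √(1 + guess ι k * ((Fintype.card ι : ℝ) - 1)) * √(1 + (h.length : ℝ)) := by
    rw [div_le_iff₀ hη]
    have hs := one_le_one_add_guess_mul k
    unfold learningRate sqrtBeta
    set s := 1 + guess ι k * ((Fintype.card ι : ℝ) - 1)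
    have h5 : b * √s * √(1 + (h.length : ℝ)) *
        (Fintype.card ι / (b * √(1 + (h.length : ℝ))) * √s) = Fintype.card ι * (√s * √s) := by
      field_simp
    rw [h5, Real.mul_self_sqrt (by linarith)]
    linarith
  linarith

end Clique

/-! ### Hedge with a decreasing learning rate -/

/-- For `|x| ≤ 1` this is the second-order Taylor bound together with `1 + x² ≤ exp (x²)`; beyond
that, the square dominates. The linear term disappears once the variable is centred. -/
theorem exp_le_add_exp_sq (x : ℝ) : Real.exp x ≤ x + Real.exp (x ^ 2) := by
  have h1 := Real.add_one_le_exp (x ^ 2)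
  rcases le_or_gt |x| 1 with h | h
  · have := (abs_le.1 (Real.abs_exp_sub_one_sub_id_le h)).2
    linarith
  · rcases lt_abs.1 h with h | h
    · have : Real.exp x ≤ Real.exp (x ^ 2) := Real.exp_le_exp.2 (by nlinarith)
      linarith
    · have : Real.exp x ≤ 1 := Real.exp_le_one_iff.2 (by linarith)
      nlinarith

section Hedge

variable {K : Type*} [Fintype K]

/-- A Hoeffding-type bound with a cruder constant: the centred losses are at most `2b` in absolute
value, whence `4 η² b²`. -/
theorem sum_mul_exp_le (p l : K → ℝ) (hp : ∀ k, 0 ≤ p k) (hp1 : ∑ k, p k = 1) {b : ℝ}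
    (hl : ∀ k, |l k| ≤ b) (η : ℝ) :
    ∑ k, p k * Real.exp (-η * l k) ≤ Real.exp (-η * ∑ k, p k * l k + 4 * η ^ 2 * b ^ 2) := by
  set μ := ∑ k, p k * l k with hμ
  have hμb : |μ| ≤ b := by
    calc |μ| ≤ ∑ k, |p k * l k| := Finset.abs_sum_le_sum_abs _ _
      _ ≤ ∑ k, p k * b := Finset.sum_le_sum fun k _ => by
          rw [abs_mul, abs_of_nonneg (hp k)]
          exact mul_le_mul_of_nonneg_left (hl k) (hp k)
      _ = b := by rw [← Finset.sum_mul, hp1, one_mul]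
  have h1 : ∀ k, Real.exp (-η * (l k - μ)) ≤ -η * (l k - μ) + Real.exp (4 * η ^ 2 * b ^ 2) := by
    intro k
    refine (exp_le_add_exp_sq _).trans (add_le_add_right (Real.exp_le_exp.2 ?_) _)
    have h2 : |l k - μ| ≤ 2 * b := (abs_sub _ _).trans (by linarith [hl k])
    have h3 : (l k - μ) ^ 2 ≤ (2 * b) ^ 2 := sq_le_sq' (neg_le_of_abs_le h2) (le_of_abs_le h2)
    nlinarith [mul_le_mul_of_nonneg_left h3 (sq_nonneg η)]
  have h2 : ∑ k, p k * Real.exp (-η * (l k - μ)) ≤ Real.exp (4 * η ^ 2 * b ^ 2) := by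
    refine (Finset.sum_le_sum fun k _ => mul_le_mul_of_nonneg_left (h1 k) (hp k)).trans_eq ?_
    have h3 : ∀ k, p k * (-η * (l k - μ) + Real.exp (4 * η ^ 2 * b ^ 2)) =
        -η * (p k * l k) + p k * (η * μ + Real.exp (4 * η ^ 2 * b ^ 2)) := fun k => by ring
    simp only [h3, Finset.sum_add_distrib, ← Finset.mul_sum, ← Finset.sum_mul, hp1, ← hμ]
    ring
  rw [Real.exp_add]
  refine le_trans (le_of_eq ?_) (mul_le_mul_of_nonneg_left h2 (Real.exp_pos _).le)
  rw [Finset.mul_sum]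
  refine Finset.sum_congr rfl fun k _ => ?_
  rw [mul_left_comm, ← Real.exp_add]
  congr 2
  ring

/-- The potential `η⁻¹ ln (mean of exp (-η Lₖ))` of Hedge. -/
def hedgePotential (η : ℝ) (L : K → ℝ) : ℝ :=
  Real.log (∑ k, (Fintype.card K : ℝ)⁻¹ * Real.exp (-η * L k)) / η

variable [Nonempty K]

theorem hedgePotential_zero (η : ℝ) : hedgePotential η (fun _ : K => 0) = 0 := by
  simp [hedgePotential]

/-- The power mean inequality with exponent `η / η' ≥ 1`. It makes lowering the learning rate free,
so the potential argument survives a rate that varies in time. -/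
theorem hedgePotential_mono {η η' : ℝ} (h0 : 0 < η') (h1 : η' ≤ η) (L : K → ℝ) :
    hedgePotential η' L ≤ hedgePotential η L := by
  have hη := h0.trans_le h1
  have hn : (0 : ℝ) < (Fintype.card K : ℝ)⁻¹ := by simp [Fintype.card_pos]
  have hpos : 0 < ∑ k, (Fintype.card K : ℝ)⁻¹ * Real.exp (-η' * L k) :=
    Finset.sum_pos (fun k _ => mul_pos hn (Real.exp_pos _)) Finset.univ_nonempty
  have h2 := Real.rpow_arith_mean_le_arith_mean_rpow Finset.univ
    (fun _ : K => (Fintype.card K : ℝ)⁻¹) (fun k => Real.exp (-η' * L k)) (fun _ _ => hn.le)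
    (by simp) (fun k _ => (Real.exp_pos _).le) ((one_le_div h0).2 h1)
  have h3 : ∀ k, Real.exp (-η' * L k) ^ (η / η') = Real.exp (-η * L k) := by
    intro k
    rw [← Real.exp_mul]
    congr 1
    field_simp
  simp only [h3] at h2
  have h4 := Real.log_le_log (Real.rpow_pos_of_pos hpos _) h2
  rw [Real.log_rpow hpos] at h4
  unfold hedgePotential
  rw [le_div_iff₀ hη]
  refine le_trans (le_of_eq ?_) h4
  ring

theorem hedgePotential_add_le {η b : ℝ} (hη : 0 < η) (L l : K → ℝ) (hl : ∀ k, |l k| ≤ b) :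
    ∑ k, Real.exp (-η * L k) / (∑ k', Real.exp (-η * L k')) * l k +
      hedgePotential η (fun k => L k + l k) ≤ hedgePotential η L + 4 * η * b ^ 2 := by
  have hn : (0 : ℝ) < (Fintype.card K : ℝ)⁻¹ := by simp [Fintype.card_pos]
  set W := ∑ k', Real.exp (-η * L k') with hWdef
  have hW : 0 < W := Finset.sum_pos (fun k _ => Real.exp_pos _) Finset.univ_nonempty
  have h1 := sum_mul_exp_le (fun k => Real.exp (-η * L k) / W) l
    (fun k => div_nonneg (Real.exp_pos _).le hW.le)
    (by rw [← Finset.sum_div, div_self hW.ne']) hl η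
  set μ := ∑ k, Real.exp (-η * L k) / W * l k
  have h2 : ∑ k, (Fintype.card K : ℝ)⁻¹ * Real.exp (-η * (L k + l k)) =
      ((Fintype.card K : ℝ)⁻¹ * W) * ∑ k, Real.exp (-η * L k) / W * Real.exp (-η * l k) := by
    rw [Finset.mul_sum]
    refine Finset.sum_congr rfl fun k _ => ?_
    rw [mul_add, Real.exp_add]
    field_simp
  have hpos : 0 < ∑ k, Real.exp (-η * L k) / W * Real.exp (-η * l k) :=
    Finset.sum_pos (fun k _ => by positivity) Finset.univ_nonempty
  have h3 := Real.log_le_log hpos h1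
  rw [Real.log_exp] at h3
  unfold hedgePotential
  rw [h2, ← Finset.mul_sum, ← hWdef, Real.log_mul (mul_pos hn hW).ne' hpos.ne', add_div]
  have h4 := div_le_div_of_nonneg_right h3 hη.le
  have h5 : (-η * μ + 4 * η ^ 2 * b ^ 2) / η = -μ + 4 * η * b ^ 2 := by
    field_simp
  linarith

theorem neg_le_hedgePotential {η : ℝ} (hη : 0 < η) (L : K → ℝ) (k : K) :
    -L k - Real.log (Fintype.card K) / η ≤ hedgePotential η L := by
  have hn : (0 : ℝ) < (Fintype.card K : ℝ)⁻¹ := by simp [Fintype.card_pos]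
  have h1 : (Fintype.card K : ℝ)⁻¹ * Real.exp (-η * L k) ≤
      ∑ k, (Fintype.card K : ℝ)⁻¹ * Real.exp (-η * L k) :=
    Finset.single_le_sum (f := fun k => (Fintype.card K : ℝ)⁻¹ * Real.exp (-η * L k))
      (fun k _ => by positivity) (Finset.mem_univ k)
  have h2 := Real.log_le_log (by positivity) h1
  rw [Real.log_mul hn.ne' (Real.exp_pos _).ne', Real.log_exp, Real.log_inv] at h2
  unfold hedgePotential
  rw [le_div_iff₀ hη]
  refine le_trans (le_of_eq ?_) h2
  field_simp
  ring

end Hedge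

/-! ### Regret of the base algorithm -/

section Clique

variable {ι : Type} [Fintype ι] {d : ℕ}

theorem inner_mtftrl (β : ℕ → ℝ) (h : History ι d) (i : ι) (v : Vec d) :
    inner ℝ v (mtftrl β h i) = ∑ k, hedgeProb β k h * inner ℝ v (expert β k h i) := by
  simp [mtftrl, Finset.sum_apply, inner_sum, inner_smul_right]

/-- The cumulative linear loss of `MT-FTRL`. -/
def mtftrlLoss (β : ℕ → ℝ) (h : History ι d) : ℝ :=
  onlineSum (fun h p => inner ℝ p.2 (mtftrl β h p.1)) h

theorem mtftrlLoss_append_singleton (β : ℕ → ℝ) (h : History ι d) (p : ι × Vec d) :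
    mtftrlLoss β (h ++ [p]) = mtftrlLoss β h + inner ℝ p.2 (mtftrl β h p.1) :=
  onlineSum_append_singleton _ h p

theorem hedgeProb_eq (β : ℕ → ℝ) (k : Fin (Fintype.card ι)) (h : History ι d) :
    hedgeProb β k h = Real.exp (-(√(Real.log (Fintype.card ι)) / β h.length) * expertLoss β k h) /
      ∑ k', Real.exp (-(√(Real.log (Fintype.card ι)) / β h.length) * expertLoss β k' h) :=
  rfl

theorem abs_inner_expert_le {b : ℝ} (β : ℕ → ℝ) (k : Fin (Fintype.card ι)) (h : History ι d)
    (i : ι) {v : Vec d} (hv : ‖v‖ ≤ b) : |inner ℝ v (expert β k h i)| ≤ b := by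
  refine (abs_real_inner_le_norm _ _).trans ?_
  have := mul_le_mul hv (norm_expert_le β k h i) (norm_nonneg _) ((norm_nonneg _).trans hv)
  linarith

theorem mtftrlLoss_add_hedgePotential_le {b : ℝ} (hb : 0 < b) (hn : 1 < Fintype.card ι)
    (h : History ι d) (hh : ∀ p ∈ h, ‖p.2‖ ≤ b) :
    mtftrlLoss (sqrtBeta b) h +
      hedgePotential (√(Real.log (Fintype.card ι)) / sqrtBeta b h.length)
        (fun k => expertLoss (sqrtBeta b) k h) ≤
      8 * (b * √(Real.log (Fintype.card ι)) * √h.length) := by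
  have : Nonempty (Fin (Fintype.card ι)) := ⟨⟨0, by omega⟩⟩
  have hc : 0 < √(Real.log (Fintype.card ι)) :=
    Real.sqrt_pos.2 (Real.log_pos (by exact_mod_cast hn))
  induction h using List.reverseRecOn with
  | nil => simp [mtftrlLoss, onlineSum_nil, expertLoss_nil, hedgePotential_zero]
  | append_singleton h p ih =>
    have ih := ih fun q hq => hh q (by simp [hq])
    have hp : ‖p.2‖ ≤ b := hh p (by simp)
    have hlen : ((h ++ [p]).length : ℝ) = h.length + 1 := by simp
    have hη : 0 < √(Real.log (Fintype.card ι)) / sqrtBeta b h.length := by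
      unfold sqrtBeta; positivity
    have hη' : 0 < √(Real.log (Fintype.card ι)) / sqrtBeta b (h ++ [p]).length := by
      unfold sqrtBeta; positivity
    have hmono : √(Real.log (Fintype.card ι)) / sqrtBeta b (h ++ [p]).length ≤
        √(Real.log (Fintype.card ι)) / sqrtBeta b h.length := by
      unfold sqrtBeta
      rw [hlen]
      gcongr
      linarith
    have h1 := hedgePotential_mono hη' hmono
      (fun k => expertLoss (sqrtBeta b) k h + inner ℝ p.2 (expert (sqrtBeta b) k h p.1))
    have h2 := hedgePotential_add_le hη (fun k => expertLoss (sqrtBeta b) k h)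
      (fun k => inner ℝ p.2 (expert (sqrtBeta b) k h p.1))
      (fun k => abs_inner_expert_le _ k h p.1 hp)
    have h3 : 4 * (√(Real.log (Fintype.card ι)) / sqrtBeta b h.length) * b ^ 2 =
        4 * (b * √(Real.log (Fintype.card ι))) * (1 / √(1 + (h.length : ℝ))) := by
      unfold sqrtBeta
      field_simp
    have h4 := mul_le_mul_of_nonneg_left (one_div_sqrt_le h.length)
      (show 0 ≤ 4 * (b * √(Real.log (Fintype.card ι))) by positivity)
    rw [mtftrlLoss_append_singleton, inner_mtftrl]
    simp only [expertLoss_append_singleton, hedgeProb_eq]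
    rw [hlen] at *
    linarith

theorem mtftrlLoss_sub_expertLoss_le {b : ℝ} (hb : 0 < b) (k : Fin (Fintype.card ι))
    (h : History ι d) (hh : ∀ p ∈ h, ‖p.2‖ ≤ b) :
    mtftrlLoss (sqrtBeta b) h - expertLoss (sqrtBeta b) k h ≤
      b * √(Real.log (Fintype.card ι)) * (8 * √h.length + √(1 + (h.length : ℝ))) := by
  have hpos : 0 < Fintype.card ι := k.pos
  rcases (show 1 ≤ Fintype.card ι from hpos).eq_or_lt with hn | hn
  -- With one agent `ln n = 0`, so the Hedge rate vanishes and the potential is useless; but there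
  -- is only one expert to follow.
  · have hs : Subsingleton (Fin (Fintype.card ι)) := by rw [← hn]; infer_instance
    have h1 : mtftrlLoss (sqrtBeta b) h = expertLoss (sqrtBeta b) k h := by
      rw [expertLoss_eq_onlineSum, mtftrlLoss]
      congr 1
      funext h p
      have hu : (Finset.univ : Finset (Fin (Fintype.card ι))) = {k} :=
        Finset.eq_singleton_iff_unique_mem.2 ⟨Finset.mem_univ _, fun _ _ => Subsingleton.elim _ _⟩
      rw [inner_mtftrl, hu, Finset.sum_singleton, hedgeProb_eq, hu, Finset.sum_singleton,
        div_self (Real.exp_pos _).ne', one_mul]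
    rw [h1, sub_self]
    positivity
  · have : Nonempty (Fin (Fintype.card ι)) := ⟨k⟩
    have hc : 0 < √(Real.log (Fintype.card ι)) :=
      Real.sqrt_pos.2 (Real.log_pos (by exact_mod_cast hn))
    have h1 := mtftrlLoss_add_hedgePotential_le hb hn h hh
    have hη : 0 < √(Real.log (Fintype.card ι)) / sqrtBeta b h.length := by
      unfold sqrtBeta; positivity
    have h2 := neg_le_hedgePotential hη (fun k => expertLoss (sqrtBeta b) k h) k
    have h3 : Real.log (Fintype.card (Fin (Fintype.card ι))) /
        (√(Real.log (Fintype.card ι)) / sqrtBeta b h.length) =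
        b * √(Real.log (Fintype.card ι)) * √(1 + (h.length : ℝ)) := by
      have h4 := Real.mul_self_sqrt (Real.log_nonneg (by exact_mod_cast hn.le :
        (1 : ℝ) ≤ Fintype.card ι))
      rw [Fintype.card_fin, sqrtBeta]
      nth_rw 1 [← h4]
      field_simp
    linarith

theorem exists_guess [Nonempty ι] (V : ι → Vec d) (hV : ∀ i, V i ∈ decisionSpace d) :
    ∃ k : Fin (Fintype.card ι), V ∈ feasible ι d (guess ι k) ∧
      guess ι k * ((Fintype.card ι : ℝ) - 1) ≤ 1 + variance V * ((Fintype.card ι : ℝ) - 1) := by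
  have hn : 0 < Fintype.card ι := Fintype.card_pos
  have hn1 : (1 : ℝ) ≤ Fintype.card ι := by exact_mod_cast hn
  have hv := variance_nonneg V
  obtain ⟨k, hk, hk'⟩ : ∃ k : Fin (Fintype.card ι),
      (guess ι k < 1 → variance V ≤ guess ι k) ∧
        guess ι k ≤ variance V + 1 / Fintype.card ι := by
    rcases lt_or_ge (variance V * Fintype.card ι) (Fintype.card ι) with h | h
    -- The index `⌊σ² n⌋` stands for the guess `(⌊σ² n⌋ + 1) / n`, which lies above `σ²` by at most
    -- `1 / n`.
    · refine ⟨⟨⌊variance V * Fintype.card ι⌋₊, (Nat.floor_lt (by positivity)).2 h⟩, fun _ => ?_, ?_⟩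
      · unfold guess
        rw [le_div_iff₀ (by positivity)]
        exact (Nat.lt_floor_add_one _).le
      · unfold guess
        rw [div_le_iff₀ (by positivity), add_mul, one_div_mul_cancel (by positivity)]
        exact add_le_add_left (Nat.floor_le (by positivity)) _
    -- The variance can reach or exceed one; the last guess imposes no constraint and is then still
    -- at most the variance.
    · refine ⟨⟨Fintype.card ι - 1, by omega⟩, fun hlt => absurd hlt ?_, ?_⟩
      · simp only [guess, Nat.cast_sub (show 1 ≤ Fintype.card ι from hn), Nat.cast_one,
          sub_add_cancel]
        rw [div_self (by positivity)]
        exact lt_irrefl _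
      · refine (guess_le_one _).trans ?_
        have : 1 ≤ variance V := by
          by_contra! h2
          nlinarith
        have : (0 : ℝ) ≤ 1 / Fintype.card ι := by positivity
        linarith
  refine ⟨k, ⟨hV, hk⟩, ?_⟩
  have h1 := mul_le_mul_of_nonneg_right hk' (sub_nonneg.2 hn1)
  have h2 : 1 / (Fintype.card ι : ℝ) * ((Fintype.card ι : ℝ) - 1) ≤ 1 := by
    rw [one_div_mul_eq_div, div_le_one (by positivity)]
    linarith
  linarith

theorem onlineSum_mtftrl_sub_le {b : ℝ} (hb : 0 ≤ b) (h : History ι d)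
    (hh : ∀ p ∈ h, ‖p.2‖ ≤ b) (V : ι → Vec d) (hV : ∀ i, V i ∈ decisionSpace d) :
    onlineSum (fun h p => inner ℝ p.2 (mtftrl (sqrtBeta b) h p.1 - V p.1)) h ≤
      24 * (1 + Real.log (Fintype.card ι)) *
        (b * √(1 + variance V * ((Fintype.card ι : ℝ) - 1)) * √h.length) := by
  -- If `b = 0` the learning rates degenerate, but all the fed losses vanish.
  rcases hb.eq_or_lt with rfl | hb
  · refine le_of_eq ?_
    rw [zero_mul, zero_mul, mul_zero]
    refine Finset.sum_eq_zero fun s _ => ?_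
    have := norm_le_zero_iff.1 (hh _ (List.get_mem h s))
    beta_reduce
    rw [this, inner_zero_left]
  -- A nonempty history supplies an agent of the clique and allows `√(1 + m) ≤ 2√m`.
  rcases h.eq_nil_or_concat with rfl | ⟨h', q, hq⟩
  · simp [onlineSum_nil]
  have hlen : (1 : ℝ) ≤ h.length := by
    rw [hq]; simp
  have : Nonempty ι := ⟨q.1⟩
  have hn1 : (1 : ℝ) ≤ Fintype.card ι := by exact_mod_cast Fintype.card_pos
  obtain ⟨k, hk, hk'⟩ := exists_guess V hV
  have h1 := expertLoss_sub_le hb k h hh hk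
  have h2 := mtftrlLoss_sub_expertLoss_le hb k h hh
  simp only [inner_sub_right, onlineSum_sub, onlineSum_inner_eq]
  change mtftrlLoss (sqrtBeta b) h - _ ≤ _
  have hvar : 0 ≤ variance V * ((Fintype.card ι : ℝ) - 1) :=
    mul_nonneg (variance_nonneg V) (by linarith)
  set s := √(1 + guess ι k * ((Fintype.card ι : ℝ) - 1))
  set r := √(1 + variance V * ((Fintype.card ι : ℝ) - 1)) with hr
  set c := √(Real.log (Fintype.card ι)) with hc
  set l := Real.log (Fintype.card ι) with hl
  have hl0 : 0 ≤ l := Real.log_nonneg hn1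
  have hc0 : 0 ≤ c := Real.sqrt_nonneg _
  have hsr : s ≤ 2 * r := by
    have h4 : (2 : ℝ) = √4 := by
      rw [show (4 : ℝ) = 2 ^ 2 by norm_num, Real.sqrt_sq (by norm_num)]
    rw [h4, hr, ← Real.sqrt_mul (by norm_num)]
    exact Real.sqrt_le_sqrt (by linarith)
  have hr1 : 1 ≤ r := Real.one_le_sqrt.2 (by linarith)
  have hcl : c ≤ (1 + l) / 2 := by
    have h3 := Real.sq_sqrt hl0
    rw [← hc] at h3
    nlinarith [sq_nonneg (c - 1)]
  have ht : √(1 + (h.length : ℝ)) ≤ 2 * √h.length := by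
    rw [Real.sqrt_le_left (by positivity), mul_pow, Real.sq_sqrt (by positivity)]
    linarith
  set t := √(h.length : ℝ)
  have ht0 : 0 ≤ t := Real.sqrt_nonneg _
  have h3 : b * s * (4 * t + √(1 + (h.length : ℝ))) ≤ b * (2 * r) * (6 * t) := by
    gcongr
    linarith
  have h4 : b * c * (8 * t + √(1 + (h.length : ℝ))) ≤ b * ((1 + l) / 2 * r) * (10 * t) := by
    have : c ≤ (1 + l) / 2 * r := hcl.trans (le_mul_of_one_le_right (by linarith) hr1)
    gcongr
    linarith
  have h5 : 0 ≤ l * (b * r * t) := by positivity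
  have h6 : 0 ≤ b * r * t := by positivity
  nlinarith

end Clique

/-! ### Neighbourhoods, weights and dominating sets -/

section Graph

variable {N : ℕ}

theorem mem_nbhd {G : SimpleGraph (Fin N)} {i j : Fin N} :
    j ∈ nbhd G i ↔ j = i ∨ G.Adj i j := by
  simp [nbhd]

theorem mem_nbhd_comm {G : SimpleGraph (Fin N)} {i j : Fin N} :
    j ∈ nbhd G i ↔ i ∈ nbhd G j := by
  rw [mem_nbhd, mem_nbhd, eq_comm, G.adj_comm]

theorem one_le_nbhdSize (G : SimpleGraph (Fin N)) (i : Fin N) : 1 ≤ nbhdSize G i :=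
  Finset.card_pos.2 ⟨i, self_mem_nbhd G i⟩

theorem nbhdSize_le_maxNbhd [NeZero N] (G : SimpleGraph (Fin N)) (i : Fin N) :
    nbhdSize G i ≤ maxNbhd G :=
  Finset.le_sup' (nbhdSize G) (Finset.mem_univ i)

theorem minNbhd_le_nbhdSize [NeZero N] (G : SimpleGraph (Fin N)) (i : Fin N) :
    minNbhd G ≤ nbhdSize G i :=
  Finset.inf'_le (nbhdSize G) (Finset.mem_univ i)

theorem one_le_minNbhd [NeZero N] (G : SimpleGraph (Fin N)) : 1 ≤ minNbhd G :=
  Finset.le_inf' _ _ fun i _ => one_le_nbhdSize G i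

theorem le_maxWeight (G : SimpleGraph (Fin N)) (w : Fin N → Fin N → ℝ) {i j : Fin N}
    (hi : i ∈ nbhd G j) : w i j ≤ maxWeight G w j :=
  Finset.le_sup' (fun i => w i j) hi

theorem maxWeight_nonneg {G : SimpleGraph (Fin N)} {w : Fin N → Fin N → ℝ} (hw : IsWeights G w)
    (j : Fin N) : 0 ≤ maxWeight G w j :=
  ((hw j).1 j (self_mem_nbhd G j)).trans (le_maxWeight G w (self_mem_nbhd G j))

theorem isWeights_uniformWeights (G : SimpleGraph (Fin N)) : IsWeights G (uniformWeights G) := by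
  intro i
  have h := one_le_nbhdSize G i
  refine ⟨fun j _ => ?_, ?_⟩
  · unfold uniformWeights
    split_ifs
    positivity
  · unfold uniformWeights
    rw [Finset.sum_congr rfl fun j hj => if_pos hj, Finset.sum_const, nsmul_eq_mul]
    exact mul_one_div_cancel (by positivity : (nbhdSize G i : ℝ) ≠ 0)

theorem maxWeight_uniformWeights_le [NeZero N] (G : SimpleGraph (Fin N)) (j : Fin N) :
    maxWeight G (uniformWeights G) j ≤ 1 / minNbhd G := by
  have h := one_le_minNbhd G
  refine Finset.sup'_le _ _ fun i hi => ?_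
  rw [uniformWeights, if_pos (mem_nbhd_comm.1 hi)]
  have := minNbhd_le_nbhdSize G i
  gcongr

theorem isWeights_delegationWeights {G : SimpleGraph (Fin N)} {r : Fin N → Fin N}
    (hr : ∀ i, r i ∈ nbhd G i) : IsWeights G (delegationWeights r) := by
  refine fun i => ⟨fun j _ => ?_, ?_⟩
  · unfold delegationWeights
    split_ifs <;> norm_num
  · simp [delegationWeights, hr i]

theorem maxWeight_delegationWeights_le (G : SimpleGraph (Fin N)) (r : Fin N → Fin N) (j : Fin N) :
    maxWeight G (delegationWeights r) j ≤ 1 := by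
  refine Finset.sup'_le _ _ fun i _ => ?_
  unfold delegationWeights
  split_ifs <;> norm_num

theorem mem_followers_delegationWeights {G : SimpleGraph (Fin N)} {r : Fin N → Fin N}
    {i j : Fin N} : i ∈ followers G (delegationWeights r) j ↔ i ∈ nbhd G j ∧ r i = j := by
  simp [followers, delegationWeights, eq_comm]

theorem exists_isDominating_card_eq (G : SimpleGraph (Fin N)) :
    ∃ S, IsDominating G S ∧ S.card = dominationNumber G :=
  Nat.sInf_mem (s := {n | ∃ S : Finset (Fin N), IsDominating G S ∧ S.card = n})
    ⟨_, Finset.univ, fun v hv => absurd (Finset.mem_univ v) hv, rfl⟩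

theorem IsDominating.exists_mem_nbhd {G : SimpleGraph (Fin N)} {S : Finset (Fin N)}
    (hS : IsDominating G S) (i : Fin N) : ∃ j, j ∈ S ∧ j ∈ nbhd G i := by
  by_cases h : i ∈ S
  · exact ⟨i, h, self_mem_nbhd G i⟩
  · obtain ⟨u, hu, hadj⟩ := hS i h
    exact ⟨u, hu, mem_nbhd.2 (Or.inr hadj)⟩

end Graph

/-! ### Reduction of the regret to the local instances -/

section Algorithm

variable {N d : ℕ}

theorem localBeta_eq (G : SimpleGraph (Fin N)) (w : Fin N → Fin N → ℝ) (j : Fin N) :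
    localBeta G w j = sqrtBeta (maxWeight G w j) :=
  rfl

theorem localHistory_succ (C : Fin N → Finset (Fin N)) (w : Fin N → Fin N → ℝ)
    (act : ℕ → Fin N) (g : ℕ → Vec d) (j : Fin N) (t : ℕ) :
    localHistory C w act g j (t + 1) = localHistory C w act g j t ++
      if ht : act t ∈ C j then [(⟨act t, ht⟩, w (act t) j • g t)] else [] := by
  unfold localHistory
  rw [List.range_succ, List.filterMap_append]
  congr 1
  split_ifs with ht <;> simp [ht]

theorem length_localHistory (C : Fin N → Finset (Fin N)) (w : Fin N → Fin N → ℝ)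
    (act : ℕ → Fin N) (g : ℕ → Vec d) (j : Fin N) (T : ℕ) :
    (localHistory C w act g j T).length = ∑ i ∈ C j, activeCount T act i := by
  induction T with
  | zero => simp [localHistory, activeCount]
  | succ T ih =>
    have h1 : ∀ i, activeCount (T + 1) act i = activeCount T act i + if act T = i then 1 else 0 := by
      intro i
      simp only [activeCount, Finset.card_filter, Finset.sum_range_succ]
    rw [localHistory_succ, List.length_append, ih]
    simp only [h1, Finset.sum_add_distrib, Finset.sum_ite_eq]
    split_ifs <;> rfl

theorem norm_le_of_mem_localHistory {G : SimpleGraph (Fin N)} {C : Fin N → Finset (Fin N)}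
    {w : Fin N → Fin N → ℝ} (hw : IsWeights G w) {act : ℕ → Fin N} {g : ℕ → Vec d} {T : ℕ}
    (hg : ∀ t < T, ‖g t‖ ≤ 1) {j : Fin N} (hC : C j ⊆ nbhd G j)
    {p : {i // i ∈ C j} × Vec d} (hp : p ∈ localHistory C w act g j T) :
    ‖p.2‖ ≤ maxWeight G w j := by
  unfold localHistory at hp
  obtain ⟨s, hs, hp⟩ := List.mem_filterMap.1 hp
  split_ifs at hp with hact
  obtain rfl := Option.some_injective _ hp
  have h1 := (hw (act s)).1 j (mem_nbhd_comm.1 (hC hact))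
  have h2 := hg s (List.mem_range.1 hs)
  rw [norm_smul, Real.norm_of_nonneg h1]
  exact (mul_le_of_le_one_right h1 h2).trans (le_maxWeight G w (hC hact))

theorem sum_range_localModel_eq_onlineSum (G : SimpleGraph (Fin N)) (C : Fin N → Finset (Fin N))
    (w : Fin N → Fin N → ℝ) (act : ℕ → Fin N) (g : ℕ → Vec d) (U : Fin N → Vec d) (j : Fin N)
    (T : ℕ) :
    (∑ t ∈ Finset.range T, if ht : act t ∈ C j then
      inner ℝ (w (act t) j • g t) (localModel G C w act g j t ⟨act t, ht⟩ - U (act t)) else 0) =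
    onlineSum (fun (h : History {i // i ∈ C j} d) p =>
        inner ℝ p.2 (mtftrl (localBeta G w j) h p.1 - U p.1))
      (localHistory C w act g j T) := by
  induction T with
  | zero => simp [localHistory, onlineSum_nil]
  | succ T ih =>
    rw [Finset.sum_range_succ, ih, localHistory_succ]
    split_ifs with hT
    · rw [onlineSum_append_singleton]
      rfl
    · rw [List.append_nil, add_zero]

theorem inner_prediction_sub {G : SimpleGraph (Fin N)} {C : Fin N → Finset (Fin N)}
    {w : Fin N → Fin N → ℝ} (hw : IsWeights G w) (hC : ∀ j, C j ⊆ nbhd G j)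
    (hC' : ∀ j, ∀ i ∈ nbhd G j, w i j ≠ 0 → i ∈ C j) (act : ℕ → Fin N) (g : ℕ → Vec d)
    (U : Fin N → Vec d) (t : ℕ) :
    inner ℝ (g t) (prediction G C w act g t - U (act t)) =
      ∑ j, if ht : act t ∈ C j then
        inner ℝ (w (act t) j • g t) (localModel G C w act g j t ⟨act t, ht⟩ - U (act t)) else 0 := by
  have hU : U (act t) = ∑ j ∈ nbhd G (act t), w (act t) j • U (act t) := by
    rw [← Finset.sum_smul, (hw (act t)).2, one_smul]
  unfold prediction
  nth_rw 1 [hU]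
  rw [← Finset.sum_sub_distrib, inner_sum]
  -- The two index sets agree up to zero terms: cliques lie inside neighbourhoods, so other `j`
  -- contribute nothing, and a neighbour whose clique omits the active agent has weight zero.
  refine Finset.sum_subset_zero_on_sdiff (Finset.subset_univ _) (fun j hj => ?_) fun j hj => ?_
  · refine dif_neg fun h => ?_
    exact (Finset.mem_sdiff.1 hj).2 (mem_nbhd_comm.1 (hC j h))
  · split_ifs with h
    · rw [← smul_sub, inner_smul_left, inner_smul_right]
      simp
    · have : w (act t) j = 0 := by
        by_contra h0
        exact h (hC' j _ (mem_nbhd_comm.1 hj) h0)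
      simp [this]

theorem regret_le {G : SimpleGraph (Fin N)} {C : Fin N → Finset (Fin N)}
    {w : Fin N → Fin N → ℝ} (hw : IsWeights G w) (hC : ∀ j, C j ⊆ nbhd G j)
    (hC' : ∀ j, ∀ i ∈ nbhd G j, w i j ≠ 0 → i ∈ C j) {T : ℕ} {act : ℕ → Fin N}
    {loss : ℕ → Vec d → ℝ} {g : ℕ → Vec d} (hrun : IsRun G C w T act loss g)
    {U : Fin N → Vec d} (hU : ∀ i, U i ∈ decisionSpace d) :
    regret G C w T act loss g U ≤ 24 * (1 + Real.log N) *
      ∑ j, maxWeight G w j *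
        √(1 + variance (fun i : {i // i ∈ C j} => U i) * (((C j).card : ℝ) - 1)) *
        √(∑ i ∈ C j, (activeCount T act i : ℝ)) := by
  have h1 : regret G C w T act loss g U ≤
      ∑ t ∈ Finset.range T, inner ℝ (g t) (prediction G C w act g t - U (act t)) := by
    refine Finset.sum_le_sum fun t ht => ?_
    have := (hrun t (Finset.mem_range.1 ht)).2.1 (U (act t)) (hU _)
    rw [← neg_sub, inner_neg_right] at this
    linarith
  refine h1.trans ?_
  simp only [inner_prediction_sub hw hC hC']
  rw [Finset.sum_comm, Finset.mul_sum]
  refine Finset.sum_le_sum fun j _ => ?_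
  rw [sum_range_localModel_eq_onlineSum, localBeta_eq]
  refine (onlineSum_mtftrl_sub_le (maxWeight_nonneg hw j) _
    (fun p hp => norm_le_of_mem_localHistory hw (fun t ht => (hrun t ht).2.2) (hC j) hp)
    (fun i : {i // i ∈ C j} => U i) fun i => hU i).trans ?_
  have hcard : Fintype.card {i // i ∈ C j} = (C j).card := Fintype.card_coe _
  have hlog : Real.log ((C j).card : ℝ) ≤ Real.log N := by
    -- A clique may be empty, since an agent need not have followers; `Real.log 0 = 0` covers that
    -- case.
    rcases (C j).card.eq_zero_or_pos with h | h
    · rw [h, Nat.cast_zero, Real.log_zero]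
      exact Real.log_natCast_nonneg N
    · have : (C j).card ≤ N := by simpa using Finset.card_le_univ (C j)
      exact Real.log_le_log (by exact_mod_cast h) (by exact_mod_cast this)
  rw [hcard, length_localHistory, Nat.cast_sum]
  have := maxWeight_nonneg hw j
  gcongr

/-! ### Local variances, activation counts and uniform weights -/

theorem localVariance_eq (G : SimpleGraph (Fin N)) (U : Fin N → Vec d) (j : Fin N) :
    localVariance G U j = variance (fun i : {i // i ∈ nbhd G j} => U i) := by
  have : Nonempty {i // i ∈ nbhd G j} := ⟨⟨j, self_mem_nbhd G j⟩⟩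
  have hcard : Fintype.card {i // i ∈ nbhd G j} = nbhdSize G j := Fintype.card_coe _
  have h1 := sum_sum_norm_sub_sq (fun i : {i // i ∈ nbhd G j} => U i)
  have h2 : ∑ i ∈ nbhd G j, ∑ i' ∈ nbhd G j, ‖U i - U i'‖ ^ 2 =
      ∑ i : {i // i ∈ nbhd G j}, ∑ k : {i // i ∈ nbhd G j}, ‖U i - U k‖ ^ 2 := by
    rw [← Finset.sum_coe_sort]
    refine Finset.sum_congr rfl fun i _ => ?_
    rw [← Finset.sum_coe_sort]
  have h0 : (nbhdSize G j : ℝ) ≠ 0 := by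
    have := one_le_nbhdSize G j
    positivity
  unfold localVariance
  rw [h2, h1, hcard, mul_div_mul_left _ _ (mul_ne_zero two_ne_zero h0), ← hcard]
  rfl

theorem localVariance_nonneg (G : SimpleGraph (Fin N)) (U : Fin N → Vec d) (j : Fin N) :
    0 ≤ localVariance G U j := by
  have : Nonempty {i // i ∈ nbhd G j} := ⟨⟨j, self_mem_nbhd G j⟩⟩
  rw [localVariance_eq]
  exact variance_nonneg _

theorem sum_activeCount (T : ℕ) (act : ℕ → Fin N) : ∑ i, activeCount T act i = T := by
  have := Finset.card_eq_sum_card_fiberwise (f := act) (s := Finset.range T)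
    (t := Finset.univ) (fun _ _ => Finset.mem_coe.2 (Finset.mem_univ _))
  rw [Finset.card_range] at this
  exact this.symm

theorem sum_nbhd_activeCount_le (G : SimpleGraph (Fin N)) (T : ℕ) (act : ℕ → Fin N) (j : Fin N) :
    ∑ i ∈ nbhd G j, (activeCount T act i : ℝ) ≤ T := by
  rw [← Nat.cast_sum]
  exact_mod_cast (Finset.sum_le_sum_of_subset (Finset.subset_univ _)).trans_eq
    (sum_activeCount T act)

/-- Double counting: by symmetry of adjacency, `T_i` occurs once for each of the `N_i`
neighbourhoods containing `i`. -/
theorem sum_sum_nbhd_activeCount_le [NeZero N] (G : SimpleGraph (Fin N)) (T : ℕ)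
    (act : ℕ → Fin N) : ∑ j, ∑ i ∈ nbhd G j, (activeCount T act i : ℝ) ≤ maxNbhd G * T := by
  rw [Finset.sum_comm' (t' := Finset.univ) (s' := fun i => nbhd G i)
    (fun j i => by simpa using mem_nbhd_comm)]
  simp only [Finset.sum_const, nsmul_eq_mul]
  have hT : (T : ℝ) = ∑ i, (activeCount T act i : ℝ) := by
    rw [← Nat.cast_sum, sum_activeCount]
  rw [hT, Finset.mul_sum]
  refine Finset.sum_le_sum fun i _ => ?_
  gcongr
  exact nbhdSize_le_maxNbhd G i

theorem sum_sqrt_le {α : Type*} (s : Finset α) {f : α → ℝ} (hf : ∀ i, 0 ≤ f i) :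
    ∑ i ∈ s, √(f i) ≤ √s.card * √(∑ i ∈ s, f i) := by
  simpa using Real.sum_sqrt_mul_sqrt_le s (f := fun _ => (1 : ℝ)) (g := f)
    (fun _ => zero_le_one) hf

theorem regret_nbhd_le {G : SimpleGraph (Fin N)} {w : Fin N → Fin N → ℝ} (hw : IsWeights G w)
    {T : ℕ} {act : ℕ → Fin N} {loss : ℕ → Vec d → ℝ} {g : ℕ → Vec d}
    (hrun : IsRun G (nbhd G) w T act loss g)
    {U : Fin N → Vec d} (hU : ∀ i, U i ∈ decisionSpace d) :
    regret G (nbhd G) w T act loss g U ≤ 24 * (1 + Real.log N) *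
      ∑ j, maxWeight G w j * √(1 + localVariance G U j * ((nbhdSize G j : ℝ) - 1)) *
        √(∑ i ∈ nbhd G j, (activeCount T act i : ℝ)) := by
  simp only [localVariance_eq]
  exact regret_le hw (fun _ => subset_rfl) (fun _ _ hi _ => hi) hrun hU

theorem sum_maxWeight_uniformWeights_le [NeZero N] (G : SimpleGraph (Fin N)) (T : ℕ)
    (act : ℕ → Fin N) (U : Fin N → Vec d) :
    ∑ j, maxWeight G (uniformWeights G) j *
        √(1 + localVariance G U j * ((nbhdSize G j : ℝ) - 1)) *
        √(∑ i ∈ nbhd G j, (activeCount T act i : ℝ)) ≤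
      min (√((N : ℝ) * maxNbhd G) / (minNbhd G : ℝ) *
          √(1 + maxVariance G U * ((maxNbhd G : ℝ) - 1)))
        ((N : ℝ) / (minNbhd G : ℝ) * √(1 + avgVariance G U * ((maxNbhd G : ℝ) - 1))) *
        √(T : ℝ) := by
  have hw := maxWeight_nonneg (isWeights_uniformWeights G)
  have hv := localVariance_nonneg G U
  have hmin := one_le_minNbhd G
  have hmax : ∀ j, (nbhdSize G j : ℝ) - 1 ≤ (maxNbhd G : ℝ) - 1 := fun j => by
    have : (nbhdSize G j : ℝ) ≤ maxNbhd G := by exact_mod_cast nbhdSize_le_maxNbhd G j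
    linarith
  have hsize : ∀ j, 0 ≤ (nbhdSize G j : ℝ) - 1 := fun j => by
    have : (1 : ℝ) ≤ nbhdSize G j := by exact_mod_cast one_le_nbhdSize G j
    linarith
  rw [min_mul_of_nonneg _ _ (Real.sqrt_nonneg _)]
  refine le_min ?_ ?_
  · have h1 : ∀ j ∈ Finset.univ, maxWeight G (uniformWeights G) j *
        √(1 + localVariance G U j * ((nbhdSize G j : ℝ) - 1)) *
        √(∑ i ∈ nbhd G j, (activeCount T act i : ℝ)) ≤
        1 / minNbhd G * √(1 + maxVariance G U * ((maxNbhd G : ℝ) - 1)) *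
          √(∑ i ∈ nbhd G j, (activeCount T act i : ℝ)) := by
      intro j _
      have h2 : localVariance G U j ≤ maxVariance G U :=
        Finset.le_sup' (localVariance G U) (Finset.mem_univ j)
      gcongr
      · exact maxWeight_uniformWeights_le G j
      · exact hsize j
      · exact (hv j).trans h2
      · exact nbhdSize_le_maxNbhd G j
    refine (Finset.sum_le_sum h1).trans ?_
    rw [← Finset.mul_sum]
    have h2 := sum_sqrt_le Finset.univ
      (f := fun j => ∑ i ∈ nbhd G j, (activeCount T act i : ℝ)) (fun j => by positivity)
    have h3 := Real.sqrt_le_sqrt (sum_sum_nbhd_activeCount_le G T act)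
    rw [Finset.card_univ, Fintype.card_fin] at h2
    calc _ ≤ 1 / minNbhd G * √(1 + maxVariance G U * ((maxNbhd G : ℝ) - 1)) *
          (√N * √(maxNbhd G * T)) := by
          gcongr
          exact h2.trans (by gcongr)
      _ = _ := by
          rw [Real.sqrt_mul (by positivity), Real.sqrt_mul (by positivity)]
          ring
  · have h1 : ∀ j ∈ Finset.univ, maxWeight G (uniformWeights G) j *
        √(1 + localVariance G U j * ((nbhdSize G j : ℝ) - 1)) *
        √(∑ i ∈ nbhd G j, (activeCount T act i : ℝ)) ≤
        1 / minNbhd G * √(1 + localVariance G U j * ((maxNbhd G : ℝ) - 1)) * √T := by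
      intro j _
      gcongr
      · exact maxWeight_uniformWeights_le G j
      · exact hv j
      · exact nbhdSize_le_maxNbhd G j
      · exact sum_nbhd_activeCount_le G T act j
    refine (Finset.sum_le_sum h1).trans ?_
    rw [← Finset.sum_mul, ← Finset.mul_sum]
    -- Here Cauchy–Schwarz is spent on the variance factors, which produces the average variance;
    -- the counts were bounded by `T` one by one.
    have h2 := sum_sqrt_le Finset.univ
      (f := fun j => 1 + localVariance G U j * ((maxNbhd G : ℝ) - 1))
      (fun j => add_nonneg zero_le_one (mul_nonneg (hv j) ((hsize j).trans (hmax j))))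
    have hN : (N : ℝ) ≠ 0 := by exact_mod_cast NeZero.ne N
    have h3 : ∑ j, (1 + localVariance G U j * ((maxNbhd G : ℝ) - 1)) =
        N * (1 + avgVariance G U * ((maxNbhd G : ℝ) - 1)) := by
      simp only [Finset.sum_add_distrib, ← Finset.sum_mul, avgVariance, Finset.sum_const,
        Finset.card_univ, Fintype.card_fin, nsmul_eq_mul]
      field_simp
    rw [Finset.card_univ, Fintype.card_fin, h3, Real.sqrt_mul (by positivity), ← mul_assoc,
      Real.mul_self_sqrt (by positivity)] at h2
    calc _ ≤ 1 / minNbhd G * (N * √(1 + avgVariance G U * ((maxNbhd G : ℝ) - 1))) * √T := by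
          gcongr
      _ = _ := by ring

/-! ### Edge variation and the dominating set -/

theorem norm_sub_sq_le_edgeVariation (G : SimpleGraph (Fin N)) (U : Fin N → Vec d) {i j : Fin N}
    (h : i ∈ nbhd G j) : ‖U i - U j‖ ^ 2 ≤ edgeVariation G U := by
  rcases mem_nbhd.1 h with rfl | hadj
  · rw [sub_self, norm_zero, zero_pow two_ne_zero]
    exact Real.iSup_nonneg fun _ => sq_nonneg _
  · rw [norm_sub_rev]
    exact le_ciSup (f := fun e : {e : Fin N × Fin N // G.Adj e.1 e.2} =>
      ‖U e.1.1 - U e.1.2‖ ^ 2) (Set.finite_range _).bddAbove ⟨(j, i), hadj⟩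

theorem edgeVariation_nonneg (G : SimpleGraph (Fin N)) (U : Fin N → Vec d) :
    0 ≤ edgeVariation G U :=
  Real.iSup_nonneg fun _ => sq_nonneg _

theorem edgeVariation_le_four (G : SimpleGraph (Fin N)) {U : Fin N → Vec d}
    (hU : ∀ i, U i ∈ decisionSpace d) : edgeVariation G U ≤ 4 := by
  refine Real.iSup_le (fun e => ?_) (by norm_num)
  have h1 := mem_closedBall_zero_iff.1 (hU e.1.1)
  have h2 := mem_closedBall_zero_iff.1 (hU e.1.2)
  have h3 := norm_sub_le (U e.1.1) (U e.1.2)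
  nlinarith [norm_nonneg (U e.1.1 - U e.1.2)]

/-- The scatter is at most the sum of squared distances to `U j`, even if `j` is not in `c`, hence
at most `N_max Δ²`. Writing this as `(N_max - 1) Δ² + Δ²` with `Δ² ≤ 4` gives the constant `5 = 1 +
4`. -/
theorem variance_subset_nbhd_le [NeZero N] (G : SimpleGraph (Fin N)) {U : Fin N → Vec d}
    (hU : ∀ i, U i ∈ decisionSpace d) {j : Fin N} {c : Finset (Fin N)} (hc : c ⊆ nbhd G j)
    (hne : c.Nonempty) :
    1 + variance (fun i : {i // i ∈ c} => U i) * ((c.card : ℝ) - 1) ≤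
      5 * (1 + edgeVariation G U * ((maxNbhd G : ℝ) - 1)) := by
  have : Nonempty {i // i ∈ c} := hne.to_subtype
  have hcard : Fintype.card {i // i ∈ c} = c.card := Fintype.card_coe _
  have h1 := variance_mul_card_sub_one (fun i : {i // i ∈ c} => U i)
  have h2 := scatter_le_sum_sub (fun i : {i // i ∈ c} => U i) (U j)
  have h3 : ∑ i : {i // i ∈ c}, ‖U i - U j‖ ^ 2 ≤ c.card * edgeVariation G U := by
    refine (Finset.sum_le_sum fun i _ => norm_sub_sq_le_edgeVariation G U (hc i.2)).trans_eq ?_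
    rw [Finset.sum_const, Finset.card_univ, hcard, nsmul_eq_mul]
  have h4 : (c.card : ℝ) ≤ maxNbhd G := by
    exact_mod_cast (Finset.card_le_card hc).trans (nbhdSize_le_maxNbhd G j)
  have h5 : (1 : ℝ) ≤ c.card := by exact_mod_cast hne.card_pos
  have h6 := edgeVariation_nonneg G U
  have h7 := edgeVariation_le_four G hU
  rw [hcard] at h1
  rw [h1]
  nlinarith [mul_le_mul_of_nonneg_right h4 h6, mul_nonneg h6 (sub_nonneg.2 (h5.trans h4))]

theorem sum_maxWeight_delegationWeights_le [NeZero N] {G : SimpleGraph (Fin N)}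
    {S : Finset (Fin N)} {r : Fin N → Fin N} (hr : ∀ i, r i ∈ S ∧ r i ∈ nbhd G i) (T : ℕ)
    (act : ℕ → Fin N) {U : Fin N → Vec d} (hU : ∀ i, U i ∈ decisionSpace d) :
    ∑ j, maxWeight G (delegationWeights r) j *
        √(1 + variance (fun i : {i // i ∈ followers G (delegationWeights r) j} => U i) *
          (((followers G (delegationWeights r) j).card : ℝ) - 1)) *
        √(∑ i ∈ followers G (delegationWeights r) j, (activeCount T act i : ℝ)) ≤
      3 * (√(1 + edgeVariation G U * ((maxNbhd G : ℝ) - 1)) * √((S.card : ℝ) * (T : ℝ))) := by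
  have hmax : 0 ≤ (maxNbhd G : ℝ) - 1 := by
    have : (1 : ℝ) ≤ maxNbhd G := by
      exact_mod_cast (one_le_nbhdSize G 0).trans (nbhdSize_le_maxNbhd G 0)
    linarith
  have hE := edgeVariation_nonneg G U
  set e := 1 + edgeVariation G U * ((maxNbhd G : ℝ) - 1) with he
  have h3 : √(5 * e) ≤ 3 * √e := by
    have : 0 ≤ e := by positivity
    rw [Real.sqrt_le_left (by positivity), mul_pow, Real.sq_sqrt this]
    linarith
  have hterm : ∀ j ∈ Finset.univ, maxWeight G (delegationWeights r) j *
        √(1 + variance (fun i : {i // i ∈ followers G (delegationWeights r) j} => U i) *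
          (((followers G (delegationWeights r) j).card : ℝ) - 1)) *
        √(∑ i ∈ followers G (delegationWeights r) j, (activeCount T act i : ℝ)) ≤
      3 * √e * √(∑ i ∈ followers G (delegationWeights r) j, (activeCount T act i : ℝ)) := by
    intro j _
    rcases (followers G (delegationWeights r) j).eq_empty_or_nonempty with h | h
    · rw [h, Finset.sum_empty, Real.sqrt_zero, mul_zero, mul_zero]
    · have h1 := variance_subset_nbhd_le G hU (Finset.filter_subset _ _) h
      have h2 := maxWeight_delegationWeights_le G r j
      refine mul_le_mul_of_nonneg_right ?_ (Real.sqrt_nonneg _)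
      refine (mul_le_of_le_one_left (Real.sqrt_nonneg _) h2).trans ?_
      exact (Real.sqrt_le_sqrt h1).trans h3
  refine (Finset.sum_le_sum hterm).trans ?_
  rw [← Finset.mul_sum, mul_assoc]
  -- The cliques are the fibres of `r`, so they partition the agents, and only those over `S` can be
  -- nonempty.
  have hfol : ∀ j, followers G (delegationWeights r) j = Finset.univ.filter fun i => r i = j := by
    intro j
    ext i
    rw [mem_followers_delegationWeights, Finset.mem_filter]
    refine ⟨fun h => ⟨Finset.mem_univ _, h.2⟩, fun h => ⟨?_, h.2⟩⟩
    exact mem_nbhd_comm.1 (h.2 ▸ (hr i).2)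
  have hsub : ∑ j, √(∑ i ∈ followers G (delegationWeights r) j, (activeCount T act i : ℝ)) =
      ∑ j ∈ S, √(∑ i ∈ followers G (delegationWeights r) j, (activeCount T act i : ℝ)) := by
    refine (Finset.sum_subset (Finset.subset_univ S) fun j _ hj => ?_).symm
    have : followers G (delegationWeights r) j = ∅ := by
      rw [hfol, Finset.filter_eq_empty_iff]
      exact fun i _ h => hj (h ▸ (hr i).1)
    rw [this, Finset.sum_empty, Real.sqrt_zero]
  have htot : ∑ j ∈ S, ∑ i ∈ followers G (delegationWeights r) j, (activeCount T act i : ℝ) =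
      T := by
    simp only [hfol]
    rw [Finset.sum_fiberwise_of_maps_to (fun i _ => (hr i).1), ← Nat.cast_sum, sum_activeCount]
  have hcs := sum_sqrt_le S
    (f := fun j => ∑ i ∈ followers G (delegationWeights r) j, (activeCount T act i : ℝ))
    (fun j => by positivity)
  rw [htot] at hcs
  rw [hsub, Real.sqrt_mul (by positivity : (0 : ℝ) ≤ S.card)]
  gcongr

end Algorithm

end

end MTCool

theorem mainTheorem1 :
    ∃ C : ℝ, 0 < C ∧ ∃ p : ℕ, ∀ (N : ℕ) [NeZero N] (G : SimpleGraph (Fin N)),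
      -- any weights
      (∀ w : Fin N → Fin N → ℝ, MTCool.IsWeights G w →
        ∀ (d T : ℕ) (act : ℕ → Fin N) (loss : ℕ → MTCool.Vec d → ℝ) (g : ℕ → MTCool.Vec d),
          MTCool.IsRun G (MTCool.nbhd G) w T act loss g →
          ∀ U : Fin N → MTCool.Vec d, (∀ i, U i ∈ MTCool.decisionSpace d) →
            MTCool.regret G (MTCool.nbhd G) w T act loss g U ≤
              C * (1 + Real.log N) ^ p *
                ∑ j, MTCool.maxWeight G w j *
                  √(1 + MTCool.localVariance G U j * ((MTCool.nbhdSize G j : ℝ) - 1)) *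
                  √(∑ i ∈ MTCool.nbhd G j, (MTCool.activeCount T act i : ℝ))) ∧
      -- uniform weights
      (∀ (d T : ℕ) (act : ℕ → Fin N) (loss : ℕ → MTCool.Vec d → ℝ) (g : ℕ → MTCool.Vec d),
          MTCool.IsRun G (MTCool.nbhd G) (MTCool.uniformWeights G) T act loss g →
          ∀ U : Fin N → MTCool.Vec d, (∀ i, U i ∈ MTCool.decisionSpace d) →
            MTCool.regret G (MTCool.nbhd G) (MTCool.uniformWeights G) T act loss g U ≤
              C * (1 + Real.log N) ^ p *
                (min
                  (√((N : ℝ) * MTCool.maxNbhd G) / (MTCool.minNbhd G : ℝ) *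
                    √(1 + MTCool.maxVariance G U * ((MTCool.maxNbhd G : ℝ) - 1)))
                  ((N : ℝ) / (MTCool.minNbhd G : ℝ) *
                    √(1 + MTCool.avgVariance G U * ((MTCool.maxNbhd G : ℝ) - 1))) *
                  √(T : ℝ))) ∧
      -- weights built from a smallest dominating set; the virtual clique of `j` consists of the
      -- agents that delegate to `j`
      (∃ w : Fin N → Fin N → ℝ, MTCool.IsWeights G w ∧
        (∃ (S : Finset (Fin N)) (r : Fin N → Fin N),
          MTCool.IsDominating G S ∧ S.card = MTCool.dominationNumber G ∧
          (∀ i, r i ∈ S ∧ r i ∈ MTCool.nbhd G i) ∧ w = MTCool.delegationWeights r) ∧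
        ∀ (d T : ℕ) (act : ℕ → Fin N) (loss : ℕ → MTCool.Vec d → ℝ) (g : ℕ → MTCool.Vec d),
          MTCool.IsRun G (MTCool.followers G w) w T act loss g →
          ∀ U : Fin N → MTCool.Vec d, (∀ i, U i ∈ MTCool.decisionSpace d) →
            MTCool.regret G (MTCool.followers G w) w T act loss g U ≤
              C * (1 + Real.log N) ^ p *
                (√(1 + MTCool.edgeVariation G U * ((MTCool.maxNbhd G : ℝ) - 1)) *
                  √((MTCool.dominationNumber G : ℝ) * (T : ℝ)))) := by
  -- The constant is `72 = 24 · 3`: `24` from the base algorithm and `3 ≥ √5` from the dominating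
  -- set bound.
  refine ⟨72, by norm_num, 1, fun N _ G => ?_⟩
  have hlog : 0 ≤ Real.log N := Real.log_natCast_nonneg N
  rw [pow_one]
  refine ⟨fun w hw d T act loss g hrun U hU => ?_, fun d T act loss g hrun U hU => ?_, ?_⟩
  · refine (MTCool.regret_nbhd_le hw hrun hU).trans ?_
    have := MTCool.maxWeight_nonneg hw
    refine mul_le_mul_of_nonneg_right (by linarith) (Finset.sum_nonneg fun j _ => ?_)
    exact mul_nonneg (mul_nonneg (this j) (Real.sqrt_nonneg _)) (Real.sqrt_nonneg _)
  · refine (MTCool.regret_nbhd_le (MTCool.isWeights_uniformWeights G) hrun hU).trans ?_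
    refine mul_le_mul (by linarith) (MTCool.sum_maxWeight_uniformWeights_le G T act U)
      (Finset.sum_nonneg fun j _ => ?_) (by positivity)
    exact mul_nonneg (mul_nonneg
      (MTCool.maxWeight_nonneg (MTCool.isWeights_uniformWeights G) j) (Real.sqrt_nonneg _))
      (Real.sqrt_nonneg _)
  · obtain ⟨S, hS, hcard⟩ := MTCool.exists_isDominating_card_eq G
    choose r hr using hS.exists_mem_nbhd
    have hw := MTCool.isWeights_delegationWeights fun i => (hr i).2
    refine ⟨MTCool.delegationWeights r, hw, ⟨S, r, hS, hcard, hr, rfl⟩,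
      fun d T act loss g hrun U hU => ?_⟩
    refine (MTCool.regret_le hw (fun j => Finset.filter_subset _ _)
      (fun j i hi h => Finset.mem_filter.2 ⟨hi, h⟩) hrun hU).trans ?_
    rw [← hcard]
    refine (mul_le_mul_of_nonneg_left (MTCool.sum_maxWeight_delegationWeights_le hr T act hU)
      (by positivity)).trans_eq ?_
    ring
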